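/- Let $p$ be a prime, $k$ a perfect field of characteristic $p$, and $n \ge 0$ an integer. A $k$-algebra $R$ is called perfect if $x \mapsto x^p$ is bijective on $R$; $W(R)$ denotes the ring of ($p$-typical) Witt vectors of $R$. For a perfect $k$-algebra $R$, a \emph{lattice} in $W(R)[1/p]^n$ is a finitely generated projective $W(R)$-submodule $L \subset W(R)[1/p]^n$ such that $L \otimes_{W(R)} W(R)[1/p] = W(R)[1/p]^n$. A lattice is \emph{free} if it is a free $W(R)$-module of rank $n$, and \emph{special} if $\wedge^n L = W(R)$ inside $\wedge^n (W(R)[1/p]^n) = W(R)[1/p]$. Let $\mathrm{Lat}_n(R)$ be the set of lattices and $\mathrm{Lat}_n^0(R) \subset \mathrm{Lat}_n(R)$ the set of special lattices. A homomorphism $R \to S$ of perfect $k$-algebras sends $L$ to $L \otimes_{W(R)} W(S)$, viewed inside $W(S)[1/p]^n$; this makes $\mathrm{Lat}_n$ a functor on perfect $k$-algebras, with $\mathrm{Lat}_n^0$ and the free (respectively free special) lattices as subfunctors. On the opposite of the category of perfect $k$-algebras consider the Zariski topology, generated by the finite families $R \to R[1/r_i]$ with the $r_i$ generating the unit ideal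 of $R$, and the fpqc topology, generated by the finite families of flat homomorphisms $R \to R_i$ which are jointly surjective on spectra. A morphism of presheaves of sets $F \to G$ is a sheafification of $F$ if $G$ is a sheaf, sections of $F$ with the same image in $G$ agree locally, every section of $G$ comes locally from $F$, and the morphism is universal among morphisms from $F$ to sheaves of sets. \textbf{Theorem.} (1) The inclusion of the functor of free lattices into $\mathrm{Lat}_n$ is a Zariski sheafification. (2) $\mathrm{Lat}_n$ is moreover an fpqc sheaf, and the inclusion of the functor of free lattices into $\mathrm{Lat}_n$ is also an fpqc sheafification. (3) The analogous assertions hold for special lattices: the inclusion of the functor of free special lattices into $\mathrm{Lat}_n^0$ is a Zariski sheafification, $\mathrm{Lat}_n^0$ is an fpqc sheaf, and the inclusion is also an fpqc sheafification. -/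

import Mathlib

open CategoryTheory Opposite

universe v u

noncomputable section

namespace WittLattice

/-! ### The ring `W(R)[1/p]` and its functoriality -/

/-- The ring `W(R)[1/p]`. -/
abbrev WInv (p : ℕ) [Fact p.Prime] (R : Type v) [CommRing R] : Type v :=
  Localization.Away (p : WittVector p R)

section Maps

variable {p : ℕ} [Fact p.Prime] {R S T : Type v} [CommRing R] [CommRing S] [CommRing T]

theorem powers_le_comap (f : R →+* S) :
    Submonoid.powers (p : WittVector p R) ≤
      (Submonoid.powers (p : WittVector p S)).comap (WittVector.map f : _ →+* _) := by
  rintro _ ⟨k, rfl⟩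
  exact ⟨k, by simp⟩

/-- The ring homomorphism `W(R)[1/p] → W(S)[1/p]` induced by `f : R → S`. -/
def mapInv (f : R →+* S) : WInv p R →+* WInv p S :=
  IsLocalization.map (WInv p S) (WittVector.map f : WittVector p R →+* WittVector p S)
    (powers_le_comap f)

@[simp] theorem mapInv_algebraMap (f : R →+* S) (x : WittVector p R) :
    mapInv f (algebraMap (WittVector p R) (WInv p R) x) =
      algebraMap (WittVector p S) (WInv p S) (WittVector.map f x) :=
  IsLocalization.map_eq _ _

theorem mapInv_id (x : WInv p R) : mapInv (RingHom.id R) x = x := by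
  have h : (mapInv (RingHom.id R) : WInv p R →+* WInv p R) = RingHom.id _ := by
    apply IsLocalization.ringHom_ext (Submonoid.powers (p : WittVector p R))
    ext x
    simp only [RingHom.comp_apply, mapInv_algebraMap, RingHom.id_apply]
    congr 1
  rw [h]; rfl

theorem mapInv_comp (f : R →+* S) (g : S →+* T) (x : WInv p R) :
    mapInv (g.comp f) x = mapInv g (mapInv f x) := by
  have h : (mapInv (g.comp f) : WInv p R →+* WInv p T) = (mapInv g).comp (mapInv f) := by
    apply IsLocalization.ringHom_ext (Submonoid.powers (p : WittVector p R))
    ext x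
    simp only [RingHom.comp_apply, mapInv_algebraMap]
    congr 1
  rw [h]; rfl

/-- The map `W(R)[1/p]^n → W(S)[1/p]^n` induced by `f : R → S`. -/
def mapVec {n : ℕ} (f : R →+* S) (x : Fin n → WInv p R) : Fin n → WInv p S :=
  fun i => mapInv f (x i)

theorem mapInv_smul (f : R →+* S) (a : WittVector p R) (x : WInv p R) :
    mapInv f (a • x) = (WittVector.map f a : WittVector p S) • mapInv f x := by
  simp [Algebra.smul_def]

theorem mapVec_smul {n : ℕ} (f : R →+* S) (a : WittVector p R) (x : Fin n → WInv p R) :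
    mapVec f (a • x) = (WittVector.map f a : WittVector p S) • mapVec f x := by
  funext i
  exact mapInv_smul f a (x i)

theorem mapVec_smulInv {n : ℕ} (f : R →+* S) (a : WInv p R) (x : Fin n → WInv p R) :
    mapVec f (a • x) = mapInv f a • mapVec f x := by
  funext i
  simp [mapVec]

theorem mapVec_add {n : ℕ} (f : R →+* S) (x y : Fin n → WInv p R) :
    mapVec f (x + y) = mapVec f x + mapVec f y := by
  funext i
  simp [mapVec]

theorem mapVec_zero {n : ℕ} (f : R →+* S) :
    mapVec f (0 : Fin n → WInv p R) = 0 := by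
  funext i
  simp [mapVec]

theorem mapVec_single {n : ℕ} (f : R →+* S) (i : Fin n) :
    mapVec f (Pi.single i 1 : Fin n → WInv p R) = Pi.single i 1 := by
  funext j
  by_cases h : j = i
  · subst h; simp [mapVec]
  · simp [mapVec, h]

end Maps

/-! ### Lattices -/

section Lattices

variable {p : ℕ} [Fact p.Prime] {n : ℕ} {R : Type v} [CommRing R]

/-- A `W(R)`-submodule `L ⊆ W(R)[1/p]^n` is a lattice if it is finitely generated and projective
and `L ⊗_{W(R)} W(R)[1/p] = W(R)[1/p]^n`. The canonical map
`L ⊗_{W(R)} W(R)[1/p] → W(R)[1/p]^n` is always injective, because localization is exact,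
so the last condition says exactly that its image, the span of `L`, is everything. -/
structure IsLattice (L : Submodule (WittVector p R) (Fin n → WInv p R)) : Prop where
  fg : L.FG
  projective : Module.Projective (WittVector p R) L
  span_eq_top : Submodule.span (WInv p R) (L : Set (Fin n → WInv p R)) = ⊤

/-- The submodule `L` is free of rank `n`. -/
def IsFreeLattice (L : Submodule (WittVector p R) (Fin n → WInv p R)) : Prop :=
  Nonempty (Module.Basis (Fin n) (WittVector p R) L)

/-- The determinant on `W(R)[1/p]^n`, regarded as a `W(R)`-multilinear alternating map. -/
def detAlt (p : ℕ) [Fact p.Prime] (n : ℕ) (R : Type v) [CommRing R] :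
    (Fin n → WInv p R) [⋀^Fin n]→ₗ[WittVector p R] WInv p R :=
  { (Matrix.detRowAlternating (n := Fin n) (R := WInv p R)).toMultilinearMap.restrictScalars
      (WittVector p R) with
    map_eq_zero_of_eq' :=
      (Matrix.detRowAlternating (n := Fin n) (R := WInv p R)).map_eq_zero_of_eq' }

/-- The map `⋀^n L → ⋀^n (W(R)[1/p]^n) = W(R)[1/p]`, where the last identification is the
determinant. -/
def detMap (L : Submodule (WittVector p R) (Fin n → WInv p R)) :
    ⋀[WittVector p R]^n L →ₗ[WittVector p R] WInv p R :=
  exteriorPower.alternatingMapLinearEquiv ((detAlt p n R).compLinearMap L.subtype)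

/-- `L` is special if `⋀^n L = W(R)` inside `⋀^n (W(R)[1/p]^n) = W(R)[1/p]`. -/
def IsSpecial (L : Submodule (WittVector p R) (Fin n → WInv p R)) : Prop :=
  LinearMap.range (detMap L) = LinearMap.range (Algebra.linearMap (WittVector p R) (WInv p R))

theorem range_detMap (L : Submodule (WittVector p R) (Fin n → WInv p R)) :
    LinearMap.range (detMap L) = Submodule.span (WittVector p R)
      (Set.range fun x : Fin n → L => Matrix.det fun i => (x i : Fin n → WInv p R)) := by
  rw [LinearMap.range_eq_map, ← exteriorPower.ιMulti_span, Submodule.map_span, ← Set.range_comp]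
  congr 2
  funext x
  exact exteriorPower.alternatingMapLinearEquiv_apply_ιMulti _ _

end Lattices

/-! ### Base change of lattices -/

section BaseChange

variable {p : ℕ} [Fact p.Prime] {n : ℕ} {R S T : Type v} [CommRing R] [CommRing S] [CommRing T]

/-- The base change of `L` along `f : R → S`: the image of `L ⊗_{W(R)} W(S)` in
`W(S)[1/p]^n`. -/
def baseChange (f : R →+* S) (L : Submodule (WittVector p R) (Fin n → WInv p R)) :
    Submodule (WittVector p S) (Fin n → WInv p S) :=
  Submodule.span (WittVector p S) (mapVec f '' (L : Set (Fin n → WInv p R)))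

theorem baseChange_span (f : R →+* S) (s : Set (Fin n → WInv p R)) :
    baseChange f (Submodule.span (WittVector p R) s) =
      Submodule.span (WittVector p S) (mapVec f '' s) := by
  apply le_antisymm
  · apply Submodule.span_le.2
    rintro _ ⟨x, hx, rfl⟩
    induction hx using Submodule.span_induction with
    | mem x hx => exact Submodule.subset_span ⟨x, hx, rfl⟩
    | zero => rw [mapVec_zero]; exact Submodule.zero_mem _
    | add x y _ _ hx hy => rw [mapVec_add]; exact Submodule.add_mem _ hx hy
    | smul a x _ hx => rw [mapVec_smul]; exact Submodule.smul_mem _ _ hx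
  · exact Submodule.span_mono (Set.image_mono Submodule.subset_span)

theorem baseChange_id (L : Submodule (WittVector p R) (Fin n → WInv p R)) :
    baseChange (RingHom.id R) L = L := by
  have h : (mapVec (RingHom.id R) : (Fin n → WInv p R) → _) = id := by
    funext x i
    exact mapInv_id _
  rw [baseChange, h, Set.image_id, Submodule.span_eq]

theorem baseChange_comp (f : R →+* S) (g : S →+* T)
    (L : Submodule (WittVector p R) (Fin n → WInv p R)) :
    baseChange (g.comp f) L = baseChange g (baseChange f L) := by
  rw [show baseChange f L = Submodule.span _ _ from rfl, baseChange_span, Set.image_image]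
  have h : (mapVec (g.comp f) : (Fin n → WInv p R) → _) = fun x => mapVec g (mapVec f x) := by
    funext x i
    exact mapInv_comp f g _
  rw [baseChange, h]

theorem algebraMap_injective [PerfectRing R p] (hp : (p : R) = 0) :
    Function.Injective (algebraMap (WittVector p R) (WInv p R)) := by
  rcases subsingleton_or_nontrivial R with hR | hR
  · intro x y _
    ext i
    exact Subsingleton.elim _ _
  · have hc : CharP R p := (CharP.charP_iff_prime_eq_zero Fact.out).2 hp
    apply IsLocalization.injective _ (M := Submonoid.powers (p : WittVector p R))
    rw [Submonoid.powers_le, mem_nonZeroDivisors_iff_right]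
    intro x hx
    rw [← WittVector.verschiebung_frobenius] at hx
    have h1 : WittVector.frobenius x = 0 :=
      WittVector.verschiebung_injective p R (hx.trans (map_zero _).symm)
    exact (WittVector.frobenius_bijective p R).1 (h1.trans (map_zero _).symm)

/-- A lattice has a finite generating family together with a dual family. -/
theorem IsLattice.exists_dual {L : Submodule (WittVector p R) (Fin n → WInv p R)}
    (hL : IsLattice L) :
    ∃ (m : ℕ) (x a : Fin m → Fin n → WInv p R),
      Submodule.span (WittVector p R) (Set.range x) = L ∧
      (∀ j i, ∃ c : WittVector p R, algebraMap _ _ c = a j ⬝ᵥ x i) ∧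
      ∀ v : Fin n → WInv p R, ∑ j, (a j ⬝ᵥ v) • x j = v := by
  have := hL.projective
  have : Module.Finite (WittVector p R) L := Module.Finite.iff_fg.2 hL.fg
  obtain ⟨m, f, g, hf, -, hfg⟩ :=
    Module.Finite.exists_comp_eq_id_of_projective (WittVector p R) L
  let M := Submonoid.powers (p : WittVector p R)
  have hu : ∀ (N : Type v) [AddCommGroup N] [Module (WittVector p R) N] [Module (WInv p R) N]
      [IsScalarTower (WittVector p R) (WInv p R) N], ∀ s : M,
      IsUnit (algebraMap (WittVector p R) (Module.End (WittVector p R) N) s) := by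
    intro N _ _ _ _ s
    obtain ⟨u, hu⟩ := IsLocalization.map_units (WInv p R) s
    rw [Module.End.isUnit_iff]
    have key : ∀ y : N, (s : WittVector p R) • y = (u : WInv p R) • y := by
      intro y
      rw [hu, algebraMap_smul]
    constructor
    · intro y z h
      simp only [Module.algebraMap_end_apply, key] at h
      have := congrArg (fun w => (↑u⁻¹ : WInv p R) • w) h
      simpa [smul_smul] using this
    · intro y
      refine ⟨(↑u⁻¹ : WInv p R) • y, ?_⟩
      simp [key, smul_smul]
  have hloc : IsLocalizedModule M L.subtype := by
    refine ⟨hu _, fun y => ?_, fun {x₁ x₂} h => ⟨1, by rw [Subtype.ext h]⟩⟩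
    obtain ⟨t, ht⟩ := multiple_mem_span_of_mem_localization_span M (WInv p R)
      (L : Set (Fin n → WInv p R)) y (by rw [hL.span_eq_top]; trivial)
    rw [Submodule.span_eq] at ht
    exact ⟨(⟨_, ht⟩, t), rfl⟩
  let l : Fin m → (Fin n → WInv p R) →ₗ[WInv p R] WInv p R := fun j =>
    (IsLocalizedModule.lift M L.subtype
      ((Algebra.linearMap (WittVector p R) (WInv p R)).comp ((LinearMap.proj j).comp g))
      (hu _)).extendScalarsOfIsLocalization M (WInv p R)
  have hl : ∀ j (y : L), l j (y : Fin n → WInv p R) = algebraMap _ _ (g y j) := fun j y =>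
    IsLocalizedModule.lift_apply M L.subtype _ (hu _) y
  have hla : ∀ j v, (fun i => l j (Pi.single i 1)) ⬝ᵥ v = l j v := by
    intro j v
    conv_rhs => rw [pi_eq_sum_univ' v, map_sum]
    simp only [dotProduct, map_smul, smul_eq_mul]
    refine Finset.sum_congr rfl fun i _ => ?_
    rw [mul_comm]
  have hfx : ∀ c, f c = ∑ j, c j • f (Pi.single j 1) := by
    intro c
    conv_lhs => rw [pi_eq_sum_univ' c, map_sum]
    exact Finset.sum_congr rfl fun j _ => map_smul f _ _
  have hid : ∀ y : L, ∑ j, (l j (y : Fin n → WInv p R)) •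
      ((f (Pi.single j 1) : L) : Fin n → WInv p R) = y := by
    intro y
    have h1 : f (g y) = y := LinearMap.congr_fun hfg y
    rw [hfx] at h1
    conv_rhs => rw [← h1]
    simp [hl]
  refine ⟨m, fun j => f (Pi.single j 1), fun j i => l j (Pi.single i 1), ?_, ?_, ?_⟩
  · apply le_antisymm
    · apply Submodule.span_le.2
      rintro _ ⟨j, rfl⟩
      exact (f _).2
    · intro y hy
      obtain ⟨c, hc⟩ := hf ⟨y, hy⟩
      rw [hfx] at hc
      have := congrArg (fun z : L => (z : Fin n → WInv p R)) hc
      simp only [Submodule.coe_sum, Submodule.coe_smul] at this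
      rw [← this]
      exact Submodule.sum_mem _ fun j _ => Submodule.smul_mem _ _
        (Submodule.subset_span ⟨j, rfl⟩)
  · intro j i
    rw [hla]
    exact ⟨_, (hl _ _).symm⟩
  · intro v
    simp only [hla]
    have hv : v ∈ Submodule.span (WInv p R) (L : Set (Fin n → WInv p R)) := by
      rw [hL.span_eq_top]; trivial
    induction hv using Submodule.span_induction with
    | mem y hy => exact hid ⟨y, hy⟩
    | zero => simp
    | add y z _ _ hy hz =>
      simp only [map_add, add_smul, Finset.sum_add_distrib, hy, hz]
    | smul a y _ hy =>
      simp only [map_smul, smul_eq_mul, mul_smul, ← Finset.smul_sum, hy]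

theorem mapInv_dotProduct (f : R →+* S) (a b : Fin n → WInv p R) :
    mapVec f a ⬝ᵥ mapVec f b = mapInv f (a ⬝ᵥ b) := by
  simp [dotProduct, mapVec]

theorem mapVec_sum (f : R →+* S) {m : ℕ} (x : Fin m → Fin n → WInv p R) :
    mapVec f (∑ j, x j) = ∑ j, mapVec f (x j) := by
  funext i
  simp [mapVec]

theorem IsLattice.of_dual [PerfectRing R p] (hp : (p : R) = 0) {m : ℕ}
    (x a : Fin m → Fin n → WInv p R)
    (hc : ∀ j i, ∃ c : WittVector p R, algebraMap _ _ c = a j ⬝ᵥ x i)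
    (hv : ∀ v : Fin n → WInv p R, ∑ j, (a j ⬝ᵥ v) • x j = v) :
    IsLattice (Submodule.span (WittVector p R) (Set.range x)) := by
  have hinj := algebraMap_injective hp
  set L := Submodule.span (WittVector p R) (Set.range x) with hLdef
  have hx : ∀ j, x j ∈ L := fun j => Submodule.subset_span ⟨j, rfl⟩
  refine ⟨⟨(Set.finite_range x).toFinset, by simp [hLdef]⟩, ?_, ?_⟩
  · have hc' : ∀ (j : Fin m) (y : L), ∃ c : WittVector p R,
        algebraMap _ _ c = a j ⬝ᵥ (y : Fin n → WInv p R) := by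
      rintro j ⟨y, hy⟩
      induction hy using Submodule.span_induction with
      | mem y hy => obtain ⟨i, rfl⟩ := hy; exact hc j i
      | zero => exact ⟨0, by simp⟩
      | add y z _ _ hy hz =>
        obtain ⟨c, hc⟩ := hy
        obtain ⟨d, hd⟩ := hz
        exact ⟨c + d, by rw [map_add, hc, hd]; exact (dotProduct_add _ _ _).symm⟩
      | smul b y _ hy =>
        obtain ⟨c, hc⟩ := hy
        refine ⟨b * c, ?_⟩
        rw [map_mul, hc, ← Algebra.smul_def]
        exact (dotProduct_smul b _ _).symm
    choose g hg using hc'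
    let s : L →ₗ[WittVector p R] (Fin m → WittVector p R) :=
      { toFun := fun y j => g j y
        map_add' := fun y z => funext fun j => hinj (by
          simp [hg, dotProduct_add])
        map_smul' := fun b y => funext fun j => hinj (by
          rw [hg, Submodule.coe_smul, dotProduct_smul, ← hg, Algebra.smul_def, ← map_mul]
          rfl) }
    let t : (Fin m → WittVector p R) →ₗ[WittVector p R] L :=
      Fintype.linearCombination (WittVector p R) fun j => (⟨x j, hx j⟩ : L)
    refine Module.Projective.of_split s t ?_
    ext1 y
    apply Subtype.ext
    have := hv y
    simp only [← hg, algebraMap_smul] at this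
    simpa [t, s, Fintype.linearCombination_apply] using this
  · rw [eq_top_iff]
    intro v _
    rw [← hv v]
    exact Submodule.sum_mem _ fun j _ => Submodule.smul_mem _ _ (Submodule.subset_span (hx j))

theorem span_map_eq_top {m : ℕ} (f : R →+* S) (x : Fin m → Fin n → WInv p R)
    (hx : Submodule.span (WInv p R) (Set.range x) = ⊤) :
    Submodule.span (WInv p S) (Set.range fun j => mapVec f (x j)) = ⊤ := by
  have key : ∀ v : Fin n → WInv p R,
      mapVec f v ∈ Submodule.span (WInv p S) (Set.range fun j => mapVec f (x j)) := by
    intro v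
    have hv : v ∈ Submodule.span (WInv p R) (Set.range x) := by rw [hx]; trivial
    induction hv using Submodule.span_induction with
    | mem y hy => obtain ⟨i, rfl⟩ := hy; exact Submodule.subset_span ⟨i, rfl⟩
    | zero => rw [mapVec_zero]; exact Submodule.zero_mem _
    | add y z _ _ hy hz => rw [mapVec_add]; exact Submodule.add_mem _ hy hz
    | smul b y _ hy => rw [mapVec_smulInv]; exact Submodule.smul_mem _ _ hy
  rw [eq_top_iff]
  intro v _
  rw [pi_eq_sum_univ' v]
  refine Submodule.sum_mem _ fun i _ => Submodule.smul_mem _ _ ?_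
  have := key (Pi.single i 1)
  rw [mapVec_single] at this
  convert this using 1

theorem IsLattice.baseChange [PerfectRing S p] (hp : (p : S) = 0) (f : R →+* S)
    {L : Submodule (WittVector p R) (Fin n → WInv p R)} (hL : IsLattice L) :
    IsLattice (baseChange f L) := by
  obtain ⟨m, x, a, rfl, hc, hv⟩ := hL.exists_dual
  rw [baseChange_span, ← Set.range_comp]
  refine IsLattice.of_dual hp (mapVec f ∘ x) (mapVec f ∘ a) (fun j i => ?_) (fun v => ?_)
  · obtain ⟨c, hc⟩ := hc j i
    exact ⟨WittVector.map f c, by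
      simp [mapInv_dotProduct, ← hc]⟩
  · let E : (Fin n → WInv p S) →ₗ[WInv p S] (Fin n → WInv p S) :=
      ∑ j, (dotProductBilin (WInv p S) (WInv p S) (mapVec f (a j))).smulRight (mapVec f (x j))
    have hE : E = LinearMap.id := by
      apply LinearMap.pi_ext'
      intro i
      ext1
      have h := congrArg (mapVec f) (hv (Pi.single i 1))
      rw [mapVec_sum] at h
      simp only [mapVec_smulInv, ← mapInv_dotProduct, mapVec_single] at h
      simpa [E] using h
    have := LinearMap.congr_fun hE v
    simpa [E] using this

theorem IsFreeLattice.baseChange [PerfectRing S p] (hp : (p : S) = 0) (f : R →+* S)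
    {L : Submodule (WittVector p R) (Fin n → WInv p R)} (hL : IsLattice L)
    (hF : IsFreeLattice L) : IsFreeLattice (baseChange f L) := by
  obtain ⟨b⟩ := hF
  let x : Fin n → Fin n → WInv p R := fun j => b j
  have hx : Submodule.span (WittVector p R) (Set.range x) = L := by
    have := congrArg (Submodule.map L.subtype) b.span_eq
    rwa [Submodule.map_span, ← Set.range_comp, Submodule.map_subtype_top] at this
  have hx' : Submodule.span (WInv p R) (Set.range x) = ⊤ := by
    rw [← hL.span_eq_top, ← hx, Submodule.span_span_of_tower]
  have hS := span_map_eq_top f x hx'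
  rw [← hx, baseChange_span, ← Set.range_comp]
  have hli : LinearIndependent (WInv p S) fun j => mapVec f (x j) := by
    rcases subsingleton_or_nontrivial (WInv p S) with h | h
    · exact linearIndependent_of_subsingleton
    · exact linearIndependent_of_top_le_span_of_card_eq_finrank hS.ge (by simp)
  have hli' : LinearIndependent (WittVector p S) (mapVec f ∘ x) :=
    hli.restrict_scalars (by
      intro c d h
      apply algebraMap_injective hp
      simpa [Algebra.smul_def] using h)
  exact ⟨Module.Basis.span hli'⟩

theorem IsSpecial.baseChange (f : R →+* S)
    {L : Submodule (WittVector p R) (Fin n → WInv p R)} (hfg : L.FG) (hS : IsSpecial L) :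
    IsSpecial (baseChange f L) := by
  obtain ⟨m, x, rfl⟩ := Submodule.fg_iff_exists_fin_generating_family.1 hfg
  unfold IsSpecial at hS ⊢
  rw [range_detMap] at hS ⊢
  have hmap : ∀ y : Fin n → Fin n → WInv p R,
      mapInv f (Matrix.det y) = Matrix.det fun i => mapVec f (y i) := fun y =>
    RingHom.map_det _ _
  apply le_antisymm
  · apply Submodule.span_le.2
    rintro _ ⟨w, rfl⟩
    have hw : ∀ i, ∃ c : Fin m → WittVector p S,
        ∑ j, c j • mapVec f (x j) = (w i : Fin n → WInv p S) := by
      intro i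
      have h : (w i : Fin n → WInv p S) ∈
          Submodule.span (WittVector p S) (Set.range (mapVec f ∘ x)) := by
        rw [Set.range_comp, ← baseChange_span]
        exact (w i).2
      exact (Submodule.mem_span_range_iff_exists_fun _).1 h
    choose c hc using hw
    have h1 : (Matrix.det fun i => (w i : Fin n → WInv p S)) =
        detAlt p n S fun i => ∑ j, c i j • mapVec f (x j) := by
      simp only [hc]
      rfl
    have h2 : ∀ r : Fin n → Fin m, detAlt p n S (fun i => mapVec f (x (r i))) ∈
        LinearMap.range (Algebra.linearMap (WittVector p S) (WInv p S)) := by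
      intro r
      have h3 : Matrix.det (fun i => x (r i)) ∈
          LinearMap.range (Algebra.linearMap (WittVector p R) (WInv p R)) := by
        rw [← hS]
        exact Submodule.subset_span ⟨fun i => ⟨x (r i), Submodule.subset_span ⟨_, rfl⟩⟩, rfl⟩
      obtain ⟨d, hd⟩ := h3
      refine ⟨WittVector.map f d, ?_⟩
      refine Eq.trans ?_ (hmap fun i => x (r i))
      rw [← hd]
      simp
    simp only [SetLike.mem_coe]
    rw [h1, ← AlternatingMap.coe_multilinearMap, MultilinearMap.map_sum]
    refine Submodule.sum_mem _ fun r _ => ?_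
    rw [MultilinearMap.map_smul_univ]
    exact Submodule.smul_mem _ _ (h2 r)
  · have h1 : (1 : WInv p R) ∈
        LinearMap.range (Algebra.linearMap (WittVector p R) (WInv p R)) := ⟨1, by simp⟩
    rw [← hS] at h1
    have h2 : ∀ z ∈ Submodule.span (WittVector p R) (Set.range fun w : Fin n →
          Submodule.span (WittVector p R) (Set.range x) =>
          Matrix.det fun i => (w i : Fin n → WInv p R)),
        mapInv f z ∈ Submodule.span (WittVector p S) (Set.range fun w : Fin n →
          WittLattice.baseChange f (Submodule.span (WittVector p R) (Set.range x)) =>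
          Matrix.det fun i => (w i : Fin n → WInv p S)) := by
      intro z hz
      induction hz using Submodule.span_induction with
      | mem z hz =>
        obtain ⟨w, rfl⟩ := hz
        exact Submodule.subset_span
          ⟨fun i => ⟨mapVec f (w i), Submodule.subset_span ⟨_, (w i).2, rfl⟩⟩, (hmap _).symm⟩
      | zero => rw [map_zero]; exact Submodule.zero_mem _
      | add y z _ _ hy hz => rw [map_add]; exact Submodule.add_mem _ hy hz
      | smul b y _ hy => rw [mapInv_smul]; exact Submodule.smul_mem _ _ hy
    have h3 := h2 1 h1
    rw [map_one] at h3
    rintro _ ⟨d, rfl⟩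
    have h4 := Submodule.smul_mem _ d h3
    rwa [Algebra.smul_def, mul_one] at h4

end BaseChange

/-! ### The category of perfect `k`-algebras and its topologies -/

section Site

variable (p : ℕ) [Fact p.Prime] (k : Type u) [Field k]

/-- The category of perfect `k`-algebras. -/
abbrev PerfAlg : Type (max u (v + 1)) :=
  ObjectProperty.FullSubcategory (C := CommAlgCat.{v} k) fun R => PerfectRing R p

/-- The opposite of the category of perfect `k`-algebras (affine perfect `k`-schemes). -/
abbrev PerfAff : Type (max u (v + 1)) := (PerfAlg.{v} p k)ᵒᵖ

variable {p k}

/-- The ring homomorphism underlying a morphism of perfect `k`-algebras. -/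
abbrev PerfAlg.toRingHom {R S : PerfAlg.{v} p k} (f : R ⟶ S) : R.obj →+* S.obj :=
  f.hom.hom.toRingHom

variable (p k)

/-- The Zariski coverings: finite families `R → R[1/r_i]`, with `r_i` generating the unit
ideal of `R`. -/
def zariskiPrecoverage : Precoverage (PerfAff.{v} p k) where
  coverings X := {P | ∃ (m : ℕ) (Y : Fin m → PerfAff.{v} p k) (f : ∀ i, Y i ⟶ X)
    (r : Fin m → X.unop.obj),
      Ideal.span (Set.range r) = ⊤ ∧
      (∀ i, letI := (PerfAlg.toRingHom (f i).unop).toAlgebra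
        IsLocalization.Away (r i) (Y i).unop.obj) ∧
      P = Presieve.ofArrows Y f}

/-- The fpqc coverings: finite families `R → R_i` of flat homomorphisms which are jointly
surjective on spectra. -/
def fpqcPrecoverage : Precoverage (PerfAff.{v} p k) where
  coverings X := {P | ∃ (m : ℕ) (Y : Fin m → PerfAff.{v} p k) (f : ∀ i, Y i ⟶ X),
      (∀ i, (PerfAlg.toRingHom (f i).unop).Flat) ∧
      (∀ x : PrimeSpectrum X.unop.obj, ∃ (i : Fin m) (y : PrimeSpectrum (Y i).unop.obj),
        PrimeSpectrum.comap (PerfAlg.toRingHom (f i).unop) y = x) ∧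
      P = Presieve.ofArrows Y f}

/-- The Zariski topology on the opposite of the category of perfect `k`-algebras. -/
def zariskiTopology : GrothendieckTopology (PerfAff.{v} p k) :=
  (zariskiPrecoverage p k).toGrothendieck

/-- The fpqc topology on the opposite of the category of perfect `k`-algebras. -/
def fpqcTopology : GrothendieckTopology (PerfAff.{v} p k) :=
  (fpqcPrecoverage p k).toGrothendieck

end Site

/-! ### The functors of lattices -/

section Functors

variable (p : ℕ) [Fact p.Prime] (k : Type u) [Field k] [CharP k p]

theorem PerfAlg.natCast_eq_zero (R : PerfAlg.{v} p k) : (p : R.obj) = 0 := by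
  rw [← map_natCast (algebraMap k R.obj) p, CharP.cast_eq_zero, map_zero]

/-- The functor `R ↦ {lattices in W(R)[1/p]^n}` on perfect `k`-algebras, regarded as a presheaf
on the opposite category. A homomorphism `R → S` acts by base change `L ↦ L ⊗_{W(R)} W(S)`. -/
def latPresheaf (n : ℕ) : (PerfAff.{v} p k)ᵒᵖ ⥤ Type v where
  obj X := {L : Submodule (WittVector p X.unop.unop.obj) (Fin n → WInv p X.unop.unop.obj) //
    IsLattice L}
  map {X Y} f := ↾fun L =>
    ⟨baseChange (PerfAlg.toRingHom f.unop.unop) L.1,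
      haveI : PerfectRing Y.unop.unop.obj p := Y.unop.unop.property
      L.2.baseChange (PerfAlg.natCast_eq_zero p k Y.unop.unop) _⟩
  map_id X := by
    refine ConcreteCategory.hom_ext _ _ fun L => ?_
    exact Subtype.ext (baseChange_id L.1)
  map_comp f g := by
    refine ConcreteCategory.hom_ext _ _ fun L => ?_
    exact Subtype.ext (baseChange_comp (PerfAlg.toRingHom f.unop.unop)
      (PerfAlg.toRingHom g.unop.unop) L.1)

/-- The subfunctor of lattices which are free of rank `n`. -/
def freeLat (n : ℕ) : Subfunctor (latPresheaf.{v} p k n) where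
  obj X := {L | IsFreeLattice L.1}
  map {X Y} f := by
    intro L hL
    have : PerfectRing Y.unop.unop.obj p := Y.unop.unop.property
    exact IsFreeLattice.baseChange (PerfAlg.natCast_eq_zero p k Y.unop.unop) _ L.2 hL

/-- The subfunctor of special lattices. -/
def specialLat (n : ℕ) : Subfunctor (latPresheaf.{v} p k n) where
  obj X := {L | IsSpecial L.1}
  map {X Y} f := by
    intro L hL
    exact IsSpecial.baseChange _ L.2.fg hL

/-- The subfunctor of free special lattices. -/
def freeSpecialLat (n : ℕ) : Subfunctor (latPresheaf.{v} p k n) :=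
  freeLat p k n ⊓ specialLat p k n

theorem freeSpecialLat_le (n : ℕ) : freeSpecialLat.{v} p k n ≤ specialLat p k n :=
  inf_le_right

end Functors

/-! ### Sheafifications -/

/-- The morphism of presheaves of sets `η : F ⟶ G` exhibits `G` as the sheafification of `F`:
`G` is a sheaf, two sections of `F` with the same image in `G` agree locally, every section of
`G` comes locally from `F`, and `η` is universal among morphisms from `F` to sheaves. -/
structure IsSheafification {C : Type*} [Category* C] (J : GrothendieckTopology C)
    {F G : Cᵒᵖ ⥤ Type v} (η : F ⟶ G) : Prop where
  isSheaf : Presheaf.IsSheaf J G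
  isLocallyInjective : Presheaf.IsLocallyInjective J η
  isLocallySurjective : Presheaf.IsLocallySurjective J η
  existsUnique_lift : ∀ H : Cᵒᵖ ⥤ Type v, Presheaf.IsSheaf J H →
    ∀ α : F ⟶ H, ∃! β : G ⟶ H, η ≫ β = α

end WittLattice

end

/-!
All the geometry of a lattice `L ⊆ W(R)[1/p]^n` is carried by *dual frames*: a finite generating
family `xⱼ` of `L` together with functionals `aⱼ`, integral on `L`, such that `∑ xⱼ aⱼᵀ = 1`. The
`aⱼ` generate the dual lattice, lattices are closed under duality, duality commutes with base
change, and membership in `L` is the integrality of finitely many elements of `W(R)[1/p]`. As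
integrality can be tested after a jointly injective family `R → Rᵢ` (`isInt_of_map`), so can
equality of lattices.

*Local freeness.* By the Cauchy–Binet formula the determinants `det (bᵢ · yⱼ)`, with the `yⱼ` in
`L` and the `bᵢ` in the dual lattice, generate the unit ideal of `W(R)` (`IsLattice.span_minors`).
Where such a determinant is invertible, Cramer's rule shows that the `yⱼ` are a basis of `L`. As
`pW(R)` lies in the Jacobson radical of `W(R)`, invertibility can be read off in `R`, so that `L` is
free on a cover of `R` by principal localizations (`IsLattice.exists_isFreeLattice_baseChange`).

*Flat descent.* Let `R → Rᵢ` be an fpqc covering and `Lᵢ` lattices which agree on the overlaps. The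
maps `W(R)/p^k → W(Rᵢ)/p^k` are flat (`WMod.flat_map`, by induction on `k` from the equational
criterion), and `W(Rᵢ)/p^k ⊗ W(Rⱼ)/p^k = W(Rᵢ ⊗ Rⱼ)/p^k` (`WMod.tensorMap_bijective`). Since each
`Lᵢ` lies between `p^N W(Rᵢ)^n` and `p^(-N) W(Rᵢ)^n`, the descent of submodules of free modules over
these rings (`mem_span_of_flat`) shows that `L₀ = {v | v ∈ Lᵢ for all i}` generates every `Lᵢ`
(`baseChange_glue`). The same holds for the dual lattices. The minors of `L₀` and of its dual
counterpart thus generate the unit ideal on the covering, hence over `R`, and Cramer's rule produces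
a dual frame: `L₀` is a lattice (`exists_isLattice_baseChange_eq`). Being special also descends,
because it is equivalent to the integrality of the determinants formed in `L` and in its dual
(`IsSpecial.of_map`).

*Sheaves.* Perfect rings are stable under tensor products, so fpqc coverings are stable under base
change and the sheaf condition needs to be checked on the covering families only. Finally, a
monomorphism to a sheaf which is locally surjective is a sheafification
(`isSheafification_of_injective`), and Zariski coverings are fpqc coverings.
-/

noncomputable section

namespace WittLattice

/-! ### Witt vectors of perfect rings -/

section Witt

variable {p : ℕ} [Fact p.Prime] {R S : Type v} [CommRing R] [CommRing S]

theorem eq_zero_of_p_mul_eq_zero [PerfectRing R p] (hp : (p : R) = 0) {x : WittVector p R}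
    (hx : (p : WittVector p R) * x = 0) : x = 0 := by
  rcases subsingleton_or_nontrivial R with hR | hR
  · ext i
    exact Subsingleton.elim _ _
  · have hc : CharP R p := (CharP.charP_iff_prime_eq_zero Fact.out).2 hp
    exact WittVector.eq_zero_of_p_mul_eq_zero x (by rwa [mul_comm])

theorem p_dvd_iff_coeff_zero [PerfectRing R p] (hp : (p : R) = 0) {x : WittVector p R} :
    (p : WittVector p R) ∣ x ↔ WittVector.constantCoeff x = 0 := by
  rcases subsingleton_or_nontrivial R with hR | hR
  · have : x = 0 := by
      ext i
      exact Subsingleton.elim _ _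
    simp [this]
  · have hc : CharP R p := (CharP.charP_iff_prime_eq_zero Fact.out).2 hp
    rw [← Ideal.mem_span_singleton]
    exact WittVector.mem_span_p_iff_coeff_zero_eq_zero x

/-- The ideal `pW(R)` lies in the Jacobson radical, because `W(R)` is `p`-adically complete. -/
theorem isUnit_iff_isUnit_constantCoeff [PerfectRing R p] (hp : (p : R) = 0)
    {x : WittVector p R} : IsUnit x ↔ IsUnit (WittVector.constantCoeff x) := by
  refine ⟨fun h => h.map _, fun h => ?_⟩
  rcases subsingleton_or_nontrivial R with hR | hR
  · rw [show x = 1 by ext i; exact Subsingleton.elim _ _]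
    exact isUnit_one
  · have hc : CharP R p := (CharP.charP_iff_prime_eq_zero Fact.out).2 hp
    obtain ⟨u, hu⟩ := h
    obtain ⟨y, hy⟩ := WittVector.constantCoeff_surjective (R := R) p (↑u⁻¹ : R)
    have h1 : (p : WittVector p R) ∣ x * y - 1 := by
      rw [p_dvd_iff_coeff_zero hp, map_sub, map_mul, hy, ← hu]
      simp
    have h2 : x * y - 1 ∈ Ideal.jacobson (⊥ : Ideal (WittVector p R)) :=
      IsAdicComplete.le_jacobson_bot _ (Ideal.mem_span_singleton.2 h1)
    have h3 := Ideal.mem_jacobson_bot.1 h2 1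
    rw [mul_one, sub_add_cancel] at h3
    exact isUnit_of_mul_isUnit_left h3

theorem constantCoeff_map (f : R →+* S) (x : WittVector p R) :
    WittVector.constantCoeff (WittVector.map f x) = f (WittVector.constantCoeff x) := rfl

/-- Divisibility by powers of `p` can be checked after a jointly injective family of ring
homomorphisms. -/
theorem p_pow_dvd_of_map {ι : Type*} {S : ι → Type v} [∀ i, CommRing (S i)]
    [PerfectRing R p] (hp : (p : R) = 0) [∀ i, PerfectRing (S i) p] (hS : ∀ i, (p : S i) = 0)
    (f : ∀ i, R →+* S i) (hf : ∀ r, (∀ i, f i r = 0) → r = 0) (k : ℕ) {x : WittVector p R}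
    (hx : ∀ i, (p : WittVector p (S i)) ^ k ∣ WittVector.map (f i) x) :
    (p : WittVector p R) ^ k ∣ x := by
  induction k generalizing x with
  | zero => simp
  | succ k ih =>
    obtain ⟨y, rfl⟩ : (p : WittVector p R) ∣ x := by
      rw [p_dvd_iff_coeff_zero hp]
      refine hf _ fun i => ?_
      rw [← constantCoeff_map, ← p_dvd_iff_coeff_zero (hS i)]
      exact (Dvd.intro _ (pow_succ' _ k).symm).trans (hx i)
    rw [pow_succ']
    refine mul_dvd_mul_left _ (ih fun i => ?_)
    obtain ⟨c, hc⟩ := hx i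
    refine ⟨c, sub_eq_zero.1 (eq_zero_of_p_mul_eq_zero (hS i) ?_)⟩
    rw [mul_sub, ← mul_assoc, ← pow_succ', ← hc, map_mul, map_natCast, sub_self]

theorem isUnit_p_pow (k : ℕ) : IsUnit (algebraMap (WittVector p R) (WInv p R) (p ^ k)) :=
  IsLocalization.map_units (WInv p R)
    (⟨_, ⟨k, rfl⟩⟩ : Submonoid.powers (p : WittVector p R))

theorem exists_p_pow_mul (z : WInv p R) :
    ∃ (k : ℕ) (x : WittVector p R),
      algebraMap (WittVector p R) (WInv p R) (p ^ k) * z = algebraMap _ _ x := by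
  obtain ⟨⟨x, ⟨_, k, rfl⟩⟩, h⟩ := IsLocalization.surj (Submonoid.powers (p : WittVector p R)) z
  exact ⟨k, x, by rw [mul_comm]; exact h⟩

/-- An element of `W(R)[1/p]` is integral, i.e. lies in `W(R)`. -/
def IsInt (z : WInv p R) : Prop := ∃ c : WittVector p R, algebraMap _ (WInv p R) c = z

theorem IsInt.map {z : WInv p R} (hz : IsInt z) (f : R →+* S) : IsInt (mapInv f z) := by
  obtain ⟨c, rfl⟩ := hz
  exact ⟨WittVector.map f c, (mapInv_algebraMap f c).symm⟩

/-- Integrality of an element of `W(R)[1/p]` can be checked after a jointly injective family of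
ring homomorphisms. -/
theorem isInt_of_map {ι : Type*} {S : ι → Type v} [∀ i, CommRing (S i)]
    [PerfectRing R p] (hp : (p : R) = 0) [∀ i, PerfectRing (S i) p] (hS : ∀ i, (p : S i) = 0)
    (f : ∀ i, R →+* S i) (hf : ∀ r, (∀ i, f i r = 0) → r = 0) {z : WInv p R}
    (hz : ∀ i, IsInt (mapInv (f i) z)) : IsInt z := by
  obtain ⟨k, x, hx⟩ := exists_p_pow_mul z
  obtain ⟨y, rfl⟩ : (p : WittVector p R) ^ k ∣ x := by
    refine p_pow_dvd_of_map hp hS f hf k fun i => ?_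
    obtain ⟨c, hc⟩ := hz i
    refine ⟨c, algebraMap_injective (hS i) ?_⟩
    rw [← mapInv_algebraMap, ← hx, map_mul, map_mul, hc, mapInv_algebraMap, map_pow, map_natCast]
  refine ⟨y, ?_⟩
  rw [map_mul] at hx
  exact ((isUnit_p_pow k).mul_right_injective hx).symm

end Witt

/-! ### Dual frames -/

section DualFrames

variable {p : ℕ} [Fact p.Prime] {n m : ℕ} {R S : Type v} [CommRing R] [CommRing S]

/-- A finite family `x` in `W(R)[1/p]^n` together with a family `a` of functionals (regarded as
vectors through the dot product) which are integral on `x` and satisfy `∑ⱼ xⱼ aⱼᵀ = 1`. These are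
the data exhibiting the span of `x` as a lattice, with `a` generating the dual lattice. -/
structure IsDualFrame (x a : Fin m → Fin n → WInv p R) : Prop where
  isInt : ∀ j i, IsInt (a j ⬝ᵥ x i)
  sum_smul : ∀ v : Fin n → WInv p R, ∑ j, (a j ⬝ᵥ v) • x j = v

variable {x a : Fin m → Fin n → WInv p R}

theorem IsDualFrame.transpose_mul (h : IsDualFrame x a) :
    (Matrix.of x).transpose * Matrix.of a = 1 := by
  ext s t
  have := congrFun (h.sum_smul (Pi.single t 1)) s
  simp only [dotProduct_single_one, Finset.sum_apply, Pi.smul_apply, smul_eq_mul] at this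
  simp only [Matrix.mul_apply, Matrix.transpose_apply, Matrix.of_apply, Matrix.one_apply]
  rw [Pi.single_apply] at this
  rw [← this]
  exact Finset.sum_congr rfl fun j _ => mul_comm _ _

theorem IsDualFrame.symm (h : IsDualFrame x a) : IsDualFrame a x := by
  refine ⟨fun j i => by rw [dotProduct_comm]; exact h.isInt i j, fun v => ?_⟩
  have h1 : (Matrix.of a).transpose * Matrix.of x = 1 := by
    rw [← Matrix.transpose_one, ← h.transpose_mul, Matrix.transpose_mul, Matrix.transpose_transpose]
  have h2 := congrArg (fun M => M.mulVec v) h1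
  simp only [Matrix.one_mulVec, ← Matrix.mulVec_mulVec] at h2
  conv_rhs => rw [← h2]
  funext s
  simp only [Finset.sum_apply, Pi.smul_apply, smul_eq_mul, Matrix.mulVec, dotProduct,
    Matrix.transpose_apply, Matrix.of_apply]
  exact Finset.sum_congr rfl fun j _ => mul_comm _ _

theorem IsDualFrame.map (h : IsDualFrame x a) (f : R →+* S) :
    IsDualFrame (mapVec f ∘ x) (mapVec f ∘ a) := by
  refine ⟨fun j i => ?_, fun v => ?_⟩
  · simp only [Function.comp_apply, mapInv_dotProduct]
    exact (h.isInt j i).map f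
  · have h1 := congrArg (fun M => M.map (mapInv f)) h.transpose_mul
    simp only [Matrix.map_mul, Matrix.map_one _ (map_zero (mapInv f)) (map_one (mapInv f))] at h1
    have h2 := congrArg (fun M => M.mulVec v) h1
    simp only [Matrix.one_mulVec, ← Matrix.mulVec_mulVec] at h2
    conv_rhs => rw [← h2]
    funext s
    simp only [Finset.sum_apply, Pi.smul_apply, smul_eq_mul, Matrix.mulVec, dotProduct,
      Matrix.transpose_apply, Matrix.of_apply, Matrix.map_apply, Function.comp_apply, mapVec]
    exact Finset.sum_congr rfl fun j _ => mul_comm _ _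

/-- The dual of a submodule of `W(R)[1/p]^n`: the vectors whose dot product with every element
of the submodule is integral. -/
def dualLattice (L : Submodule (WittVector p R) (Fin n → WInv p R)) :
    Submodule (WittVector p R) (Fin n → WInv p R) where
  carrier := {a | ∀ y ∈ L, IsInt (a ⬝ᵥ y)}
  add_mem' := by
    intro a b ha hb y hy
    obtain ⟨c, hc⟩ := ha y hy
    obtain ⟨d, hd⟩ := hb y hy
    exact ⟨c + d, by rw [map_add, hc, hd, add_dotProduct]⟩
  zero_mem' := fun y _ => ⟨0, by simp⟩
  smul_mem' := by
    intro w a ha y hy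
    obtain ⟨c, hc⟩ := ha y hy
    exact ⟨w * c, by rw [map_mul, hc, smul_dotProduct, Algebra.smul_def]⟩

theorem mem_dualLattice_span {b : Fin n → WInv p R} :
    b ∈ dualLattice (Submodule.span (WittVector p R) (Set.range x)) ↔
      ∀ j, IsInt (x j ⬝ᵥ b) := by
  constructor
  · intro h j
    rw [dotProduct_comm]
    exact h _ (Submodule.subset_span ⟨j, rfl⟩)
  · intro h y hy
    induction hy using Submodule.span_induction with
    | mem y hy => obtain ⟨j, rfl⟩ := hy; rw [dotProduct_comm]; exact h j
    | zero => exact ⟨0, by simp⟩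
    | add y z _ _ hy hz =>
      obtain ⟨c, hc⟩ := hy
      obtain ⟨d, hd⟩ := hz
      exact ⟨c + d, by rw [map_add, hc, hd, dotProduct_add]⟩
    | smul w y _ hy =>
      obtain ⟨c, hc⟩ := hy
      exact ⟨w * c, by rw [map_mul, hc, dotProduct_smul, Algebra.smul_def]⟩

/-- The lattice spanned by a dual frame is its own bidual. -/
theorem IsDualFrame.mem_span_iff (h : IsDualFrame x a) {v : Fin n → WInv p R} :
    v ∈ Submodule.span (WittVector p R) (Set.range x) ↔ ∀ j, IsInt (a j ⬝ᵥ v) := by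
  rw [← mem_dualLattice_span]
  constructor
  · intro hv b hb
    rw [dotProduct_comm]
    refine (mem_dualLattice_span (x := x)).2 (fun j => ?_) v hv
    revert b
    change ∀ b ∈ _, _
    have : x j ∈ dualLattice (Submodule.span (WittVector p R) (Set.range a)) :=
      mem_dualLattice_span.2 fun i => h.isInt i j
    exact fun b hb => this b hb
  · intro hv
    rw [← h.sum_smul v]
    refine Submodule.sum_mem _ fun j _ => ?_
    obtain ⟨c, hc⟩ := mem_dualLattice_span.1 hv j
    rw [← hc, algebraMap_smul]
    exact Submodule.smul_mem _ _ (Submodule.subset_span ⟨j, rfl⟩)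

theorem IsDualFrame.dualLattice_span (h : IsDualFrame x a) :
    dualLattice (Submodule.span (WittVector p R) (Set.range x)) =
      Submodule.span (WittVector p R) (Set.range a) := by
  ext b
  rw [mem_dualLattice_span, h.symm.mem_span_iff]

theorem IsLattice.exists_isDualFrame {L : Submodule (WittVector p R) (Fin n → WInv p R)}
    (hL : IsLattice L) : ∃ (m : ℕ) (x a : Fin m → Fin n → WInv p R), IsDualFrame x a ∧
      L = Submodule.span (WittVector p R) (Set.range x) := by
  obtain ⟨m, x, a, hx, hc, hv⟩ := hL.exists_dual
  exact ⟨m, x, a, ⟨hc, hv⟩, hx.symm⟩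

theorem IsDualFrame.isLattice [PerfectRing R p] (hp : (p : R) = 0) (h : IsDualFrame x a) :
    IsLattice (Submodule.span (WittVector p R) (Set.range x)) :=
  .of_dual hp x a h.isInt h.sum_smul

theorem IsLattice.dualLattice [PerfectRing R p] (hp : (p : R) = 0)
    {L : Submodule (WittVector p R) (Fin n → WInv p R)} (hL : IsLattice L) :
    IsLattice (dualLattice L) := by
  obtain ⟨m, x, a, h, rfl⟩ := hL.exists_isDualFrame
  rw [h.dualLattice_span]
  exact h.symm.isLattice hp

theorem IsLattice.dualLattice_baseChange {L : Submodule (WittVector p R) (Fin n → WInv p R)}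
    (hL : IsLattice L) (f : R →+* S) :
    WittLattice.dualLattice (WittLattice.baseChange f L) =
      WittLattice.baseChange f (WittLattice.dualLattice L) := by
  obtain ⟨m, x, a, h, rfl⟩ := hL.exists_isDualFrame
  rw [h.dualLattice_span, baseChange_span, baseChange_span, ← Set.range_comp, ← Set.range_comp,
    (h.map f).dualLattice_span]

/-- Membership in a lattice can be checked after a jointly injective family of ring
homomorphisms. -/
theorem IsLattice.mem_of_map {ι : Type*} {S : ι → Type v} [∀ i, CommRing (S i)]
    [PerfectRing R p] (hp : (p : R) = 0) [∀ i, PerfectRing (S i) p] (hS : ∀ i, (p : S i) = 0)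
    (f : ∀ i, R →+* S i) (hf : ∀ r, (∀ i, f i r = 0) → r = 0)
    {L : Submodule (WittVector p R) (Fin n → WInv p R)} (hL : IsLattice L)
    {v : Fin n → WInv p R} (hv : ∀ i, mapVec (f i) v ∈ WittLattice.baseChange (f i) L) :
    v ∈ L := by
  obtain ⟨m, x, a, h, rfl⟩ := hL.exists_isDualFrame
  rw [h.mem_span_iff]
  intro j
  refine isInt_of_map hp hS f hf fun i => ?_
  have h1 := hv i
  rw [baseChange_span, ← Set.range_comp, (h.map (f i)).mem_span_iff] at h1
  have h2 := h1 j
  rwa [Function.comp_apply, mapInv_dotProduct] at h2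

end DualFrames

/-! ### Minors of dual frames -/

section Minors

variable {p : ℕ} [Fact p.Prime] {n m : ℕ} {R S : Type v} [CommRing R] [CommRing S]

/-- A consequence of the Cauchy–Binet formula: if `X A = 1` for an `n × m` matrix `X` and an
`m × n` matrix `A`, then the principal `n × n` minors of `A X` sum to `1`. They are the
coefficient of degree `n` of `det (1 + T A X) = det (1 + T X A) = (1 + T) ^ n`. -/
theorem sum_principal_minors_eq_one {A : Type*} [CommRing A] (X : Matrix (Fin n) (Fin m) A)
    (Y : Matrix (Fin m) (Fin n) A) (h : X * Y = 1) :
    ∑ s ∈ Finset.univ.powersetCard n,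
      ((Y * X).submatrix (Subtype.val : s → Fin m) (Subtype.val : s → Fin m)).det = 1 := by
  open Polynomial in
  have h1 := Matrix.coeff_det_one_add_X_smul_eq_sum_minors (Y * X) n
  rw [← h1, Matrix.map_mul, ← Matrix.smul_mul, Matrix.det_one_add_mul_comm, Matrix.mul_smul,
    ← Matrix.map_mul, h, Matrix.map_one _ C.map_zero C.map_one]
  have h2 : (1 + (Polynomial.X : A[X]) • (1 : Matrix (Fin n) (Fin n) A[X])) =
      Matrix.scalar (Fin n) (1 + Polynomial.X) := by
    rw [Matrix.smul_one_eq_diagonal, ← Matrix.diagonal_one, Matrix.diagonal_add]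
    rfl
  rw [h2, Matrix.scalar_apply, Matrix.det_diagonal, Finset.prod_const, Finset.card_univ,
    Fintype.card_fin, Polynomial.coeff_one_add_X_pow, Nat.choose_self, Nat.cast_one]

/-- The elements of `W(R)` which are determinants `det (bᵢ · yⱼ)` with all `yⱼ` in `L` and all
`bᵢ` in `L'`. -/
def minors (L L' : Submodule (WittVector p R) (Fin n → WInv p R)) : Set (WittVector p R) :=
  {d | ∃ y b : Fin n → Fin n → WInv p R, (∀ i, y i ∈ L) ∧ (∀ i, b i ∈ L') ∧
    algebraMap _ (WInv p R) d = (Matrix.of fun i j => b i ⬝ᵥ y j).det}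

/-- The principal minors of the matrix `(aⱼ · xᵢ)` sum to `1`. -/
theorem IsDualFrame.span_minors [PerfectRing R p] (hp : (p : R) = 0)
    {x a : Fin m → Fin n → WInv p R} (h : IsDualFrame x a) :
    Ideal.span (minors (Submodule.span (WittVector p R) (Set.range x))
      (Submodule.span (WittVector p R) (Set.range a))) = ⊤ := by
  choose c hc using h.isInt
  have h1 := sum_principal_minors_eq_one _ _ h.transpose_mul
  have h2 : Matrix.of a * (Matrix.of x).transpose =
      (algebraMap (WittVector p R) (WInv p R)).mapMatrix (Matrix.of c) := by
    ext j i
    simp only [RingHom.mapMatrix_apply, Matrix.map_apply, Matrix.of_apply, hc]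
    rfl
  have h3 : ∑ s ∈ Finset.univ.powersetCard n, ((Matrix.of c).submatrix
      (Subtype.val : s → Fin m) (Subtype.val : s → Fin m)).det = 1 := by
    apply algebraMap_injective hp
    rw [map_sum, map_one, ← h1, h2]
    refine Finset.sum_congr rfl fun s _ => ?_
    rw [RingHom.map_det]
    rfl
  rw [Ideal.eq_top_iff_one, ← h3]
  refine Ideal.sum_mem _ fun s hs => Ideal.subset_span ?_
  let e : Fin n ≃ s := (Fintype.equivFinOfCardEq (by simpa using hs)).symm
  refine ⟨fun i => x (e i), fun i => a (e i), fun i => Submodule.subset_span ⟨_, rfl⟩,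
    fun i => Submodule.subset_span ⟨_, rfl⟩, ?_⟩
  rw [RingHom.map_det, ← Matrix.det_submatrix_equiv_self e]
  congr 1
  ext i j
  simp [hc]

theorem IsLattice.span_minors [PerfectRing R p] (hp : (p : R) = 0)
    {L : Submodule (WittVector p R) (Fin n → WInv p R)} (hL : IsLattice L) :
    Ideal.span (minors L (WittLattice.dualLattice L)) = ⊤ := by
  obtain ⟨m, x, a, h, rfl⟩ := hL.exists_isDualFrame
  rw [h.dualLattice_span]
  exact h.span_minors hp

theorem minors_map (f : R →+* S) {L L' : Submodule (WittVector p R) (Fin n → WInv p R)}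
    {d : WittVector p R} (hd : d ∈ minors L L') :
    WittVector.map f d ∈ minors (baseChange f L) (baseChange f L') := by
  obtain ⟨y, b, hy, hb, h⟩ := hd
  refine ⟨fun i => mapVec f (y i), fun i => mapVec f (b i),
    fun i => Submodule.subset_span ⟨_, hy i, rfl⟩,
    fun i => Submodule.subset_span ⟨_, hb i, rfl⟩, ?_⟩
  rw [← mapInv_algebraMap, h, RingHom.map_det]
  congr 1
  ext i j
  simp [mapInv_dotProduct]

/-- Cramer's rule for the Gram matrix of two families of `n` vectors in `A ^ n`. -/
theorem det_smul_eq_sum_adjugate {A : Type*} [CommRing A] (y b : Fin n → Fin n → A)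
    (v : Fin n → A) :
    (Matrix.of fun i j => b i ⬝ᵥ y j).det • v =
      ∑ i, ((∑ j, (Matrix.of fun i j => b i ⬝ᵥ y j).adjugate i j • b j) ⬝ᵥ v) • y i := by
  set Y := (Matrix.of y).transpose with hY
  set B := Matrix.of b with hB
  have hD : (Matrix.of fun i j => b i ⬝ᵥ y j) = B * Y := rfl
  have h1 : Y * (B * Y).adjugate * B = (B * Y).det • (1 : Matrix (Fin n) (Fin n) A) := by
    rw [Matrix.adjugate_mul_distrib, ← mul_assoc, Matrix.mul_adjugate, mul_assoc,
      Matrix.adjugate_mul, Matrix.det_mul]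
    simp [smul_smul]
  have h2 := congrArg (fun M => M.mulVec v) h1
  simp only [Matrix.smul_mulVec, Matrix.one_mulVec, ← Matrix.mulVec_mulVec] at h2
  rw [hD, ← h2, hY, Matrix.mulVec_eq_sum]
  refine Finset.sum_congr rfl fun i _ => ?_
  rw [Matrix.transpose_transpose]
  change _ • y i = _
  rw [op_smul_eq_smul]
  congr 1
  simp only [sum_dotProduct, smul_dotProduct, smul_eq_mul]
  rfl

/-- If `det (bᵢ · yⱼ)` is a unit of `W(R)`, with all `yⱼ` in `L` and all `bᵢ` in the dual of
`L`, then the `yⱼ` form a basis of `L`. -/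
theorem isFreeLattice_of_isUnit [PerfectRing R p] (hp : (p : R) = 0)
    {L : Submodule (WittVector p R) (Fin n → WInv p R)} {d : WittVector p R}
    (hd : d ∈ minors L (dualLattice L)) (hu : IsUnit d) : IsFreeLattice L := by
  obtain ⟨y, b, hy, hb, h⟩ := hd
  choose c hc using fun i j => hb i (y j) (hy j)
  have hD : (Matrix.of fun i j => b i ⬝ᵥ y j) =
      (algebraMap (WittVector p R) (WInv p R)).mapMatrix (Matrix.of c) := by
    ext i j
    simp [hc]
  have hadj : ∀ i j, (Matrix.of fun i j => b i ⬝ᵥ y j).adjugate i j =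
      algebraMap _ _ ((Matrix.of c).adjugate i j) := by
    intro i j
    rw [hD, ← RingHom.map_adjugate]
    rfl
  have hspan : Submodule.span (WittVector p R) (Set.range y) = L := by
    apply le_antisymm
    · rw [Submodule.span_le]
      rintro _ ⟨i, rfl⟩
      exact hy i
    · intro v hv
      have h1 := det_smul_eq_sum_adjugate y b v
      rw [← h, algebraMap_smul] at h1
      obtain ⟨u, rfl⟩ := hu
      have h2 : v = (↑u⁻¹ : WittVector p R) • ((u : WittVector p R) • v) := by
        rw [smul_smul, Units.inv_mul, one_smul]
      rw [h2, h1]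
      refine Submodule.smul_mem _ _ (Submodule.sum_mem _ fun i _ => ?_)
      have h3 : (∑ j, (Matrix.of fun i j => b i ⬝ᵥ y j).adjugate i j • b j) ∈ dualLattice L := by
        refine Submodule.sum_mem _ fun j _ => ?_
        rw [hadj, algebraMap_smul]
        exact Submodule.smul_mem _ _ (hb j)
      obtain ⟨e, he⟩ := h3 v hv
      rw [← he, algebraMap_smul]
      exact Submodule.smul_mem _ _ (Submodule.subset_span ⟨i, rfl⟩)
  have hY : IsUnit (Matrix.of y).det := by
    have h1 : (Matrix.of fun i j => b i ⬝ᵥ y j) = Matrix.of b * (Matrix.of y).transpose := rfl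
    have h2 := hu.map (algebraMap (WittVector p R) (WInv p R))
    rw [h, h1, Matrix.det_mul, Matrix.det_transpose] at h2
    exact isUnit_of_mul_isUnit_right h2
  have hli : LinearIndependent (WInv p R) y :=
    Matrix.linearIndependent_rows_of_isUnit ((Matrix.isUnit_iff_isUnit_det _).2 hY)
  have hli' : LinearIndependent (WittVector p R) y :=
    hli.restrict_scalars (by
      intro c d h
      apply algebraMap_injective hp
      simpa [Algebra.smul_def] using h)
  rw [← hspan]
  exact ⟨Module.Basis.span hli'⟩

/-- Conversely to `IsLattice.span_minors`: if two submodules in integral duality have minors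
generating the unit ideal, then they contain a dual frame. -/
theorem exists_isDualFrame_of_span_minors
    {L L' : Submodule (WittVector p R) (Fin n → WInv p R)} (hL : L' ≤ dualLattice L)
    (h : Ideal.span (minors L L') = ⊤) :
    ∃ (m : ℕ) (x a : Fin m → Fin n → WInv p R),
      IsDualFrame x a ∧ (∀ j, x j ∈ L) ∧ ∀ j, a j ∈ L' := by
  let E : Submodule (WittVector p R) (Matrix (Fin n) (Fin n) (WInv p R)) :=
    Submodule.span _ {M | ∃ x ∈ L, ∃ a ∈ L', M = Matrix.vecMulVec x a}
  have hE : ∀ d ∈ Ideal.span (minors L L'), d • (1 : Matrix (Fin n) (Fin n) (WInv p R)) ∈ E := by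
    intro d hd
    induction hd using Submodule.span_induction with
    | zero => rw [zero_smul]; exact zero_mem _
    | add d e _ _ hd he => rw [add_smul]; exact add_mem hd he
    | smul c d _ hd => rw [smul_eq_mul, mul_smul]; exact Submodule.smul_mem _ _ hd
    | mem d hd =>
      obtain ⟨y, b, hy, hb, h⟩ := hd
      choose c hc using fun i j => hL (hb i) (y j) (hy j)
      have hD : (Matrix.of fun i j => b i ⬝ᵥ y j) =
          (algebraMap (WittVector p R) (WInv p R)).mapMatrix (Matrix.of c) := by
        ext i j
        simp [hc]
      have h1 : d • (1 : Matrix (Fin n) (Fin n) (WInv p R)) = ∑ i, Matrix.vecMulVec (y i)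
          (∑ j, (Matrix.of fun i j => b i ⬝ᵥ y j).adjugate i j • b j) := by
        apply Matrix.toLin'.injective
        ext v : 2
        have := det_smul_eq_sum_adjugate y b (Pi.single v 1)
        rw [← h, algebraMap_smul] at this
        simp only [LinearMap.coe_comp, LinearMap.coe_single, Function.comp_apply,
          Matrix.toLin'_apply, Matrix.sum_mulVec, Matrix.vecMulVec_mulVec,
          op_smul_eq_smul]
        rw [← this, Matrix.smul_mulVec, Matrix.one_mulVec]
      rw [h1]
      refine Submodule.sum_mem _ fun i _ => Submodule.subset_span ⟨_, hy i, _, ?_, rfl⟩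
      refine Submodule.sum_mem _ fun j _ => ?_
      rw [hD, ← RingHom.map_adjugate, RingHom.mapMatrix_apply, Matrix.map_apply, algebraMap_smul]
      exact Submodule.smul_mem _ _ (hb j)
  have h1 := hE 1 (by rw [h]; trivial)
  rw [one_smul] at h1
  obtain ⟨m, c, g, hg⟩ := Submodule.mem_span_set'.1 h1
  choose x hx a ha hxa using fun i => (g i).2
  refine ⟨m, fun j => c j • x j, a,
    ⟨fun j i => hL (ha j) _ (Submodule.smul_mem _ _ (hx i)), fun v => ?_⟩,
    fun j => Submodule.smul_mem _ _ (hx j), ha⟩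
  have h2 := congrArg (fun M => M.mulVec v) hg
  simp only [hxa, Matrix.sum_mulVec, Matrix.smul_mulVec, Matrix.vecMulVec_mulVec,
    op_smul_eq_smul, Matrix.one_mulVec] at h2
  conv_rhs => rw [← h2]
  exact Finset.sum_congr rfl fun j _ => smul_comm _ _ _

/-- Whether a lattice is special can be checked after a jointly injective family of ring
homomorphisms. -/
theorem IsSpecial.of_map {ι : Type*} {S : ι → Type v} [∀ i, CommRing (S i)]
    [PerfectRing R p] (hp : (p : R) = 0) [∀ i, PerfectRing (S i) p] (hS : ∀ i, (p : S i) = 0)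
    (f : ∀ i, R →+* S i) (hf : ∀ r, (∀ i, f i r = 0) → r = 0)
    {L : Submodule (WittVector p R) (Fin n → WInv p R)} (hL : IsLattice L)
    (hs : ∀ i, IsSpecial (WittLattice.baseChange (f i) L)) : IsSpecial L := by
  have hdet : ∀ i (y : Fin n → Fin n → WInv p R),
      mapInv (f i) (Matrix.det (Matrix.of y)) =
        Matrix.det (Matrix.of fun j => mapVec (f i) (y j)) :=
    fun i y => RingHom.map_det _ _
  -- In a special lattice, determinants are integral, and so are those in its dual lattice.
  have hdetL : ∀ y : Fin n → Fin n → WInv p R, (∀ i, y i ∈ L) →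
      IsInt (Matrix.det (Matrix.of y)) := by
    intro y hy
    refine isInt_of_map hp hS f hf fun i => ?_
    rw [hdet]
    have h1 := hs i
    unfold IsSpecial at h1
    rw [range_detMap] at h1
    have h2 : Matrix.det (Matrix.of fun j => mapVec (f i) (y j)) ∈
        LinearMap.range (Algebra.linearMap (WittVector p (S i)) (WInv p (S i))) := by
      rw [← h1]
      exact Submodule.subset_span
        ⟨fun j => ⟨mapVec (f i) (y j), Submodule.subset_span ⟨_, hy j, rfl⟩⟩, rfl⟩
    exact h2
  have hdetD : ∀ b : Fin n → Fin n → WInv p R, (∀ i, b i ∈ dualLattice L) →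
      IsInt (Matrix.det (Matrix.of b)) := by
    intro b hb
    refine isInt_of_map hp hS f hf fun i => ?_
    rw [hdet]
    have h1 := hs i
    unfold IsSpecial at h1
    rw [range_detMap] at h1
    have hb' : ∀ j, mapVec (f i) (b j) ∈ dualLattice (WittLattice.baseChange (f i) L) := by
      intro j
      rw [hL.dualLattice_baseChange]
      exact Submodule.subset_span ⟨_, hb j, rfl⟩
    have h2 : ∀ z ∈ Submodule.span (WittVector p (S i)) (Set.range
        fun x : Fin n → WittLattice.baseChange (f i) L =>
          Matrix.det fun j => (x j : Fin n → WInv p (S i))),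
        IsInt (Matrix.det (Matrix.of fun j => mapVec (f i) (b j)) * z) := by
      intro z hz
      induction hz using Submodule.span_induction with
      | zero => exact ⟨0, by simp⟩
      | add y z _ _ hy hz =>
        obtain ⟨c, hc⟩ := hy
        obtain ⟨d, hd⟩ := hz
        exact ⟨c + d, by rw [map_add, hc, hd, mul_add]⟩
      | smul w y _ hy =>
        obtain ⟨c, hc⟩ := hy
        exact ⟨w * c, by rw [map_mul, hc, Algebra.smul_def, mul_left_comm]⟩
      | mem z hz =>
        obtain ⟨y, rfl⟩ := hz
        choose c hc using fun j l => hb' j _ (y l).2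
        refine ⟨(Matrix.of c).det, ?_⟩
        rw [RingHom.map_det]
        change _ = _ * Matrix.det (Matrix.of fun j => (y j : Fin n → WInv p (S i)))
        rw [← Matrix.det_transpose (Matrix.of fun j => (y j : Fin n → WInv p (S i))),
          ← Matrix.det_mul]
        congr 1
        ext j l
        simp only [RingHom.mapMatrix_apply, Matrix.map_apply, Matrix.of_apply, hc]
        rfl
    rw [h1] at h2
    simpa using h2 1 ⟨1, by simp⟩
  unfold IsSpecial
  rw [range_detMap]
  apply le_antisymm
  · rw [Submodule.span_le]
    rintro _ ⟨y, rfl⟩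
    exact hdetL _ fun i => (y i).2
  · -- Expand `1` as a combination of minors `det (bᵢ · yⱼ) = det b * det y`.
    have h1 : ∀ d ∈ Ideal.span (minors L (dualLattice L)), algebraMap _ (WInv p R) d ∈
        Submodule.span (WittVector p R) (Set.range fun x : Fin n → L =>
          Matrix.det fun i => (x i : Fin n → WInv p R)) := by
      intro d hd
      induction hd using Submodule.span_induction with
      | zero => rw [map_zero]; exact zero_mem _
      | add d e _ _ hd he => rw [map_add]; exact add_mem hd he
      | smul c d _ hd =>
        rw [smul_eq_mul, map_mul, ← Algebra.smul_def]
        exact Submodule.smul_mem _ _ hd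
      | mem d hd =>
        obtain ⟨y, b, hy, hb, h⟩ := hd
        have h2 : (Matrix.of fun i j => b i ⬝ᵥ y j) = Matrix.of b * (Matrix.of y).transpose := rfl
        obtain ⟨e, he⟩ := hdetD b hb
        rw [h, h2, Matrix.det_mul, Matrix.det_transpose, ← he, ← Algebra.smul_def]
        exact Submodule.smul_mem _ _ (Submodule.subset_span ⟨fun i => ⟨y i, hy i⟩, rfl⟩)
    rintro _ ⟨d, rfl⟩
    exact h1 d (by rw [hL.span_minors hp]; trivial)

end Minors

/-! ### Flat descent of submodules of a free module -/

section Descent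

open TensorProduct

/-- Descent of submodules of `Aⁿ` along a finite family of `A`-algebras `B i`. If `x ∈ B₀ⁿ`, where
`B₀` is flat over `A`, and if over each `B₀ ⊗ B i` the vector `x` lies in the base change of
`K i ⊆ (B i)ⁿ`, then `x` is a `B₀`-linear combination of vectors of `Aⁿ` whose image lies in every
`K i`. For the proof, consider the `A`-linear map `Aⁿ → ∏ (B i)ⁿ / K i`, and apply the equational
criterion for the vanishing of the image of `x` in `B₀ ⊗ ∏ (B i)ⁿ / K i`. -/
theorem mem_span_of_flat {A B₀ : Type v} {ι : Type} [Fintype ι] {B : ι → Type v} [CommRing A]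
    [CommRing B₀] [∀ i, CommRing (B i)] [Algebra A B₀] [∀ i, Algebra A (B i)] [Module.Flat A B₀]
    {n : ℕ} (K : ∀ i, Submodule (B i) (Fin n → B i)) (x : Fin n → B₀)
    (hx : ∀ i, (fun s => x s ⊗ₜ[A] (1 : B i)) ∈ Submodule.span (B₀ ⊗[A] B i)
      ((fun (z : Fin n → B i) s => (1 : B₀) ⊗ₜ[A] z s) '' (K i : Set (Fin n → B i)))) :
    x ∈ Submodule.span B₀ ((fun (v : Fin n → A) s => algebraMap A B₀ (v s)) ''
      {v | ∀ i, (fun s => algebraMap A (B i) (v s)) ∈ K i}) := by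
  classical
  let Q : ι → Type v := fun i => (Fin n → B i) ⧸ K i
  let q : Fin n → ∀ i, Q i := fun s i => (K i).mkQ (Pi.single s 1)
  have hq : ∀ i (w : Fin n → B i), ∑ s, w s • q s i = (K i).mkQ w := by
    intro i w
    simp only [q, ← map_smul, ← map_sum]
    congr 1
    exact (pi_eq_sum_univ' w).symm
  have hi : ∀ i, ∑ s, q s i ⊗ₜ[A] x s = 0 := by
    intro i
    let φ : Fin n → B₀ ⊗[A] B i →ₗ[A] Q i ⊗[A] B₀ := fun s =>
      (TensorProduct.comm A B₀ (Q i)).toLinearMap ∘ₗ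
        LinearMap.lTensor B₀ ((LinearMap.toSpanSingleton (B i) (Q i) (q s i)).restrictScalars A)
    have hφ : ∀ s b b', φ s (b ⊗ₜ b') = (b' • q s i) ⊗ₜ b := fun s b b' => rfl
    have hΦ : ∀ u ∈ Submodule.span (B₀ ⊗[A] B i)
        ((fun (z : Fin n → B i) s => (1 : B₀) ⊗ₜ[A] z s) '' (K i : Set (Fin n → B i))),
        ∀ d, ∑ s, φ s (d * u s) = 0 := by
      intro u hu
      induction hu using Submodule.span_induction with
      | zero => simp
      | add u w _ _ hu hw =>
        intro d
        simp only [Pi.add_apply, mul_add, map_add, Finset.sum_add_distrib, hu, hw, add_zero]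
      | smul e u _ hu =>
        intro d
        simpa only [Pi.smul_apply, smul_eq_mul, mul_assoc] using hu (d * e)
      | mem u hu =>
        obtain ⟨z, hz, rfl⟩ := hu
        intro d
        induction d using TensorProduct.induction_on with
        | zero => simp
        | add d e hd he => simp only [add_mul, map_add, Finset.sum_add_distrib, hd, he, add_zero]
        | tmul b b' =>
          simp only [Algebra.TensorProduct.tmul_mul_tmul, mul_one, hφ, ← TensorProduct.sum_tmul,
            mul_smul, ← Finset.smul_sum, hq]
          rw [Submodule.mkQ_apply, (Submodule.Quotient.mk_eq_zero _).2 hz, smul_zero,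
            TensorProduct.zero_tmul]
    simpa [hφ] using hΦ _ (hx i) 1
  have hz : ∑ s, q s ⊗ₜ[A] x s = 0 := by
    have h1 : ∀ s, q s ⊗ₜ[A] x s =
        ∑ i, LinearMap.rTensor B₀ (LinearMap.single A Q i) (q s i ⊗ₜ[A] x s) := by
      intro s
      simp only [LinearMap.rTensor_tmul, ← TensorProduct.sum_tmul]
      congr 1
      exact (Finset.univ_sum_single (q s)).symm
    simp only [h1]
    rw [Finset.sum_comm]
    refine Finset.sum_eq_zero fun i _ => ?_
    rw [← map_sum, hi, map_zero]
  obtain ⟨k, a, y, hay, hav⟩ :=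
    TensorProduct.vanishesTrivially_of_sum_tmul_eq_zero_of_rTensor_injective A
      (Module.Flat.rTensor_preserves_injective_linearMap _ (Submodule.injective_subtype _)) hz
  have hx' : x = ∑ j, y j • fun s => algebraMap A B₀ (a s j) := by
    funext s
    rw [hay, Finset.sum_apply]
    exact Finset.sum_congr rfl fun j _ => by
      rw [Pi.smul_apply, smul_eq_mul, mul_comm, Algebra.smul_def]
  rw [hx']
  refine Submodule.sum_mem _ fun j _ => Submodule.smul_mem _ _ (Submodule.subset_span
    ⟨fun s => a s j, fun i => ?_, rfl⟩)
  rw [← Submodule.Quotient.mk_eq_zero, ← Submodule.mkQ_apply, ← hq]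
  have := congrFun (hav j) i
  simpa [Finset.sum_apply, algebraMap_smul] using this

end Descent

/-! ### Witt vectors modulo powers of `p`: flatness and tensor products -/

section TruncatedWitt

open TensorProduct

/-- Nilpotent lifting of bijectivity: a ring homomorphism `D → C` is bijective if it is so modulo
the image of an element `π` with `π ^ (k + 1) = 0` and the annihilator of `π` in `C` is
`π ^ k C`. -/
theorem bijective_of_mod_nilpotent {D C : Type*} [CommRing D] [CommRing C] (g : D →+* C) (π : D)
    (k : ℕ) (hk : π ^ (k + 1) = 0) (hsurj : ∀ c, ∃ d e, c = g d + g π * e)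
    (hker : ∀ d, g π ∣ g d → π ∣ d) (hann : ∀ c, g π * c = 0 → g π ^ k ∣ c) :
    Function.Bijective g := by
  have hsurj' : ∀ (j : ℕ) c, ∃ d e, c = g d + g π ^ j * e := by
    intro j
    induction j with
    | zero => exact fun c => ⟨0, c, by simp⟩
    | succ j ih =>
      intro c
      obtain ⟨d, e, rfl⟩ := ih c
      obtain ⟨d', e', rfl⟩ := hsurj e
      exact ⟨d + π ^ j * d', e', by simp only [map_add, map_mul, map_pow]; ring⟩
  refine ⟨(injective_iff_map_eq_zero g).2 fun d hd => ?_, fun c => ?_⟩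
  · have h1 : ∀ j : ℕ, ∀ d, g d = 0 → ∃ e, g e = 0 ∧ d = π ^ j * e := by
      intro j
      induction j with
      | zero => exact fun d hd => ⟨d, hd, by simp⟩
      | succ j ih =>
        intro d hd
        obtain ⟨e, he, rfl⟩ := ih d hd
        obtain ⟨e, rfl⟩ := hker e (by rw [he]; exact dvd_zero _)
        obtain ⟨c, hc⟩ := hann (g e) (by rw [← map_mul, he])
        obtain ⟨d', e', rfl⟩ := hsurj c
        refine ⟨e - π ^ k * d', ?_, ?_⟩
        · have : g π ^ (k + 1) = 0 := by rw [← map_pow, hk, map_zero]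
          rw [map_sub, hc, map_mul, map_pow, mul_add, add_sub_cancel_left, ← mul_assoc, ← pow_succ,
            this, zero_mul]
        · linear_combination (π ^ j * d') * hk
    obtain ⟨e, -, rfl⟩ := h1 (k + 1) d hd
    rw [hk, zero_mul]
  · obtain ⟨d, e, rfl⟩ := hsurj' (k + 1) c
    exact ⟨d, by rw [← map_pow, hk, map_zero, zero_mul, add_zero]⟩

/-- The inductive step in the equational criterion of flatness modulo powers of `π`: a relation
`(a, b)` trivialised modulo `π` by `(c, y)`, with errors `b'` and `d`, is trivialised modulo
`π ^ (k + 1)` once the relation `(d, y) + (a, b')` is trivialised modulo `π ^ k` by `(e, z)`. -/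
theorem trivial_relation_step {A B ι κ₁ κ : Type*} [CommRing A] [CommRing B] [Fintype ι]
    [Fintype κ₁] [Fintype κ] (φ : A →+* B) (π : A) (k : ℕ) {a : ι → A} {b b' : ι → B}
    {c : ι → κ₁ → A} {y : κ₁ → B} {d : κ₁ → A} {e₁ : κ₁ → κ → A} {e₂ : ι → κ → A} {z : κ → B}
    {u : κ₁ → B} {w : ι → B} {r : κ → A}
    (hb : ∀ i, b i - ∑ j, φ (c i j) * y j = φ π * b' i) (hd : ∀ j, ∑ i, a i * c i j = π * d j)
    (hu : ∀ j, y j - ∑ t, φ (e₁ j t) * z t = φ π ^ k * u j)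
    (hw : ∀ i, b' i - ∑ t, φ (e₂ i t) * z t = φ π ^ k * w i)
    (hr : ∀ t, ∑ j, d j * e₁ j t + ∑ i, a i * e₂ i t = π ^ k * r t) :
    (∀ i, φ π ^ (k + 1) ∣ b i - ∑ s, φ (Sum.elim (fun t => ∑ j, c i j * e₁ j t + π * e₂ i t)
      (fun j => π ^ k * c i j) s) * Sum.elim z u s) ∧
    ∀ s, π ^ (k + 1) ∣ ∑ i, a i * Sum.elim (fun t => ∑ j, c i j * e₁ j t + π * e₂ i t)
      (fun j => π ^ k * c i j) s := by
  constructor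
  · intro i
    refine ⟨w i, ?_⟩
    simp only [Fintype.sum_sum_type, Sum.elim_inl, Sum.elim_inr, map_add, map_sum, map_mul,
      map_pow]
    have h5 : ∑ j, φ (c i j) * y j =
        ∑ t, (∑ j, φ (c i j) * φ (e₁ j t)) * z t + ∑ j, φ π ^ k * φ (c i j) * u j := by
      have h7 : ∀ j, φ (c i j) * y j =
          ∑ t, φ (c i j) * φ (e₁ j t) * z t + φ π ^ k * φ (c i j) * u j := fun j => by
        rw [eq_add_of_sub_eq' (hu j), mul_add, Finset.mul_sum]
        congr 1
        · exact Finset.sum_congr rfl fun t _ => (mul_assoc _ _ _).symm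
        · ring
      rw [Finset.sum_congr rfl fun j _ => h7 j, Finset.sum_add_distrib, Finset.sum_comm]
      simp only [Finset.sum_mul]
    have h6 : ∑ t, φ π * φ (e₂ i t) * z t = φ π * ∑ t, φ (e₂ i t) * z t := by
      rw [Finset.mul_sum]
      exact Finset.sum_congr rfl fun t _ => mul_assoc _ _ _
    simp only [add_mul, Finset.sum_add_distrib]
    rw [h6]
    linear_combination hb i + h5 + φ π * hw i
  · rintro (t | j)
    · refine ⟨r t, ?_⟩
      have h4 : ∑ i, a i * ∑ j, c i j * e₁ j t = π * ∑ j, d j * e₁ j t := by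
        simp only [Finset.mul_sum]
        rw [Finset.sum_comm]
        refine Finset.sum_congr rfl fun j _ => ?_
        rw [← mul_assoc, ← hd, Finset.sum_mul]
        exact Finset.sum_congr rfl fun i _ => (mul_assoc _ _ _).symm
      have h5 : ∑ i, a i * (π * e₂ i t) = π * ∑ i, a i * e₂ i t := by
        rw [Finset.mul_sum]
        exact Finset.sum_congr rfl fun i _ => mul_left_comm _ _ _
      simp only [Sum.elim_inl, mul_add, Finset.sum_add_distrib]
      rw [h4, h5, ← mul_add, hr, pow_succ', mul_assoc]
    · refine ⟨d j, ?_⟩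
      simp only [Sum.elim_inr]
      rw [pow_succ, mul_assoc, ← hd, Finset.mul_sum]
      exact Finset.sum_congr rfl fun i _ => mul_left_comm _ _ _

/-- The error of a relation `(a, b)` modulo `π ^ (k + 1)` trivialised modulo `π` is a relation
modulo `π ^ k`. -/
theorem relation_step {A B ι κ₁ : Type*} [CommRing A] [CommRing B] [Fintype ι] [Fintype κ₁]
    (φ : A →+* B) (π : A) (k : ℕ) (hπ : ∀ x, φ π * x = 0 → x = 0) {a : ι → A} {b b' : ι → B}
    {c : ι → κ₁ → A} {y : κ₁ → B} {d : κ₁ → A} (h : φ π ^ (k + 1) ∣ ∑ i, φ (a i) * b i)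
    (hb : ∀ i, b i - ∑ j, φ (c i j) * y j = φ π * b' i) (hd : ∀ j, ∑ i, a i * c i j = π * d j) :
    φ π ^ k ∣ ∑ s : κ₁ ⊕ ι, φ (Sum.elim d a s) * Sum.elim y b' s := by
  obtain ⟨β, hβ⟩ := h
  refine ⟨β, sub_eq_zero.1 (hπ _ ?_)⟩
  rw [mul_sub, ← mul_assoc, ← pow_succ', ← hβ, Fintype.sum_sum_type]
  simp only [Sum.elim_inl, Sum.elim_inr]
  have h5 : ∑ i, φ (a i) * ∑ j, φ (c i j) * y j = φ π * ∑ j, φ (d j) * y j := by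
    simp only [Finset.mul_sum]
    rw [Finset.sum_comm]
    refine Finset.sum_congr rfl fun j _ => ?_
    rw [← mul_assoc, ← map_mul, ← hd, map_sum, Finset.sum_mul]
    exact Finset.sum_congr rfl fun i _ => by rw [map_mul, mul_assoc]
  have h6 : ∑ i, φ (a i) * b i =
      ∑ i, φ (a i) * ∑ j, φ (c i j) * y j + φ π * ∑ i, φ (a i) * b' i := by
    rw [Finset.mul_sum, ← Finset.sum_add_distrib]
    exact Finset.sum_congr rfl fun i _ => by rw [eq_add_of_sub_eq' (hb i)]; ring
  rw [h6, h5, mul_add, sub_self]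

variable {p : ℕ} [Fact p.Prime] {R S T : Type v} [CommRing R] [CommRing S] [CommRing T]

/-- The ring `W(R) / p ^ k`. -/
abbrev WMod (p : ℕ) [Fact p.Prime] (k : ℕ) (R : Type v) [CommRing R] : Type v :=
  WittVector p R ⧸ Ideal.span {(p : WittVector p R) ^ k}

theorem mk_eq_zero_iff_dvd {k : ℕ} {x : WittVector p R} :
    (Ideal.Quotient.mk (Ideal.span {(p : WittVector p R) ^ k}) x) = 0 ↔
      (p : WittVector p R) ^ k ∣ x := by
  rw [Ideal.Quotient.eq_zero_iff_mem, Ideal.mem_span_singleton]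

/-- The ring homomorphism `W(R) / p ^ k → W(S) / p ^ k` induced by `f : R → S`. -/
def WMod.map (k : ℕ) (f : R →+* S) : WMod p k R →+* WMod p k S :=
  Ideal.quotientMap _ (WittVector.map f : WittVector p R →+* WittVector p S) (by
    rw [Ideal.span_singleton_le_iff_mem, Ideal.mem_comap, map_pow, map_natCast]
    exact Ideal.mem_span_singleton_self _)

@[simp] theorem WMod.map_mk (k : ℕ) (f : R →+* S) (x : WittVector p R) :
    WMod.map k f (Ideal.Quotient.mk _ x) = Ideal.Quotient.mk _ (WittVector.map f x) := rfl

theorem WMod.map_comp (k : ℕ) (f : R →+* S) (g : S →+* T) (x : WMod p k R) :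
    WMod.map k (g.comp f) x = WMod.map k g (WMod.map k f x) := by
  obtain ⟨x, rfl⟩ := Ideal.Quotient.mk_surjective x
  rfl

/-- The equational criterion of flatness for `W(R) / p ^ k → W(S) / p ^ k`: a relation with
coefficients `a` modulo `p ^ (k + 1)` is first trivialised modulo `p`, because `S` is flat over
`R`. As `W(S)` has no `p`-torsion, the error is `p` times a relation modulo `p ^ k`, to which
induction applies. -/
theorem exists_trivial_relation [PerfectRing R p] [PerfectRing S p] (hR : (p : R) = 0)
    (hS : (p : S) = 0) (f : R →+* S) (hf : f.Flat) (k : ℕ) :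
    ∀ {ι : Type} [Fintype ι] (a : ι → WittVector p R) (b : ι → WittVector p S),
      (p : WittVector p S) ^ k ∣ ∑ i, WittVector.map f (a i) * b i →
      ∃ (κ : Type) (_ : Fintype κ) (c : ι → κ → WittVector p R) (y : κ → WittVector p S),
        (∀ i, (p : WittVector p S) ^ k ∣ b i - ∑ j, WittVector.map f (c i j) * y j) ∧
        ∀ j, (p : WittVector p R) ^ k ∣ ∑ i, a i * c i j := by
  algebraize [f]
  have hfa : algebraMap R S = f := rfl
  induction k with
  | zero => exact fun a b _ => ⟨Empty, inferInstance, fun _ => Empty.elim, Empty.elim, by simp⟩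
  | succ k ih =>
    intro ι _ a b h
    have h1 : ∑ i, WittVector.constantCoeff (a i) • WittVector.constantCoeff (b i) = 0 := by
      have h2 := (p_dvd_iff_coeff_zero hS).1 ((Dvd.intro _ (pow_succ' _ k).symm).trans h)
      rw [map_sum] at h2
      rw [← h2]
      exact Finset.sum_congr rfl fun i _ => by
        rw [map_mul, constantCoeff_map, Algebra.smul_def, hfa]
    obtain ⟨l, c₀, y₀, hb, ha⟩ :=
      Module.Flat.isTrivialRelation_of_sum_smul_eq_zero (R := R) (M := S) h1
    beta_reduce at hb ha
    have hsR := WittVector.constantCoeff_surjective (R := R) p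
    have hsS := WittVector.constantCoeff_surjective (R := S) p
    choose c hc using fun i j => hsR (c₀ i j)
    choose y hy using fun j => hsS (y₀ j)
    have hb' : ∀ i, (p : WittVector p S) ∣ b i - ∑ j, WittVector.map f (c i j) * y j := by
      intro i
      rw [p_dvd_iff_coeff_zero hS, map_sub, map_sum, sub_eq_zero, hb]
      exact Finset.sum_congr rfl fun j _ => by
        rw [map_mul, constantCoeff_map, hc, hy, Algebra.smul_def, hfa]
    have ha' : ∀ j, (p : WittVector p R) ∣ ∑ i, a i * c i j := by
      intro j
      rw [p_dvd_iff_coeff_zero hR, map_sum, ← ha j]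
      exact Finset.sum_congr rfl fun i _ => by rw [map_mul, hc]
    choose b' hb' using hb'
    choose d hd using ha'
    have hφ : WittVector.map f (p : WittVector p R) = p := map_natCast _ _
    simp only [← hφ] at h hb'
    have h3 := relation_step (WittVector.map f) (p : WittVector p R) k
      (fun x hx => eq_zero_of_p_mul_eq_zero hS (by rwa [hφ] at hx)) h hb' hd
    rw [hφ] at h3
    obtain ⟨κ, _, e, z, he, hz⟩ := ih _ _ h3
    choose u hu using fun j => he (.inl j)
    choose w hw using fun i => he (.inr i)
    choose r hr using hz
    simp only [Sum.elim_inl, Sum.elim_inr, Fintype.sum_sum_type, ← hφ] at hu hw hr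
    have h4 := trivial_relation_step (WittVector.map f) (p : WittVector p R) k
      hb' hd hu hw hr
    rw [hφ] at h4
    exact ⟨κ ⊕ Fin l, inferInstance, _, _, h4⟩

theorem WMod.flat_map [PerfectRing R p] [PerfectRing S p] (hR : (p : R) = 0)
    (hS : (p : S) = 0) (f : R →+* S) (hf : f.Flat) (k : ℕ) :
    (WMod.map k f : WMod p k R →+* WMod p k S).Flat := by
  let := (WMod.map k f : WMod p k R →+* WMod p k S).toAlgebra
  refine Module.Flat.of_forall_isTrivialRelation fun {l} {a} {b} h => ?_
  choose a' ha using fun i => Ideal.Quotient.mk_surjective (a i)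
  choose b' hb using fun i => Ideal.Quotient.mk_surjective (b i)
  have hsmul : ∀ (r : WittVector p R) (s : WittVector p S),
      (Ideal.Quotient.mk _ r : WMod p k R) • (Ideal.Quotient.mk _ s : WMod p k S) =
        Ideal.Quotient.mk _ (WittVector.map f r * s) := fun r s => rfl
  obtain ⟨κ, _, c, y, h1, h2⟩ := exists_trivial_relation hR hS f hf k a' b' (by
    rw [← mk_eq_zero_iff_dvd, ← h, map_sum]
    exact Finset.sum_congr rfl fun i _ => by rw [← ha, ← hb, hsmul])
  rw [Module.isTrivialRelation_iff_vanishesTrivially]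
  refine TensorProduct.VanishesTrivially.of_fintype (κ := κ)
    (fun i j => Ideal.Quotient.mk _ (c i j)) (fun j => Ideal.Quotient.mk _ (y j))
    (fun i => ?_) fun j => ?_
  · have := mk_eq_zero_iff_dvd.2 (h1 i)
    rw [map_sub, sub_eq_zero, hb, map_sum] at this
    rw [this]
    rfl
  · have := mk_eq_zero_iff_dvd.2 (h2 j)
    rw [← this, map_sum]
    exact Finset.sum_congr rfl fun i _ => by rw [← ha, smul_eq_mul, mul_comm, map_mul]

end TruncatedWitt

section TensorWitt

open TensorProduct

variable {p : ℕ} [Fact p.Prime] {R S T : Type v} [CommRing R] [CommRing S] [CommRing T]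

/-- The tensor product of perfect rings of characteristic `p` over a perfect ring is perfect: the
inverse of Frobenius is the tensor product of the inverses. -/
theorem perfectRing_tensorProduct (hp : (p : R) = 0) [Algebra R S] [Algebra R T] [PerfectRing R p]
    [PerfectRing S p] [PerfectRing T p] : PerfectRing (S ⊗[R] T) p := by
  rcases subsingleton_or_nontrivial (S ⊗[R] T) with h | h
  · exact ⟨⟨fun x y _ => Subsingleton.elim x y, fun x => ⟨x, Subsingleton.elim _ _⟩⟩⟩
  have hc : ∀ (A : Type v) [CommRing A] [Algebra R A] [Nontrivial A], CharP A p := fun A _ _ _ =>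
    (CharP.charP_iff_prime_eq_zero Fact.out).2 (by
      rw [← map_natCast (algebraMap R A), hp, map_zero])
  have hRn : Nontrivial R := (algebraMap R (S ⊗[R] T)).domain_nontrivial
  have hSn : Nontrivial S :=
    (Algebra.TensorProduct.includeLeftRingHom : S →+* S ⊗[R] T).domain_nontrivial
  have hTn : Nontrivial T :=
    (Algebra.TensorProduct.includeRight : T →ₐ[R] S ⊗[R] T).toRingHom.domain_nontrivial
  have := hc R
  have := hc S
  have := hc T
  have := hc (S ⊗[R] T)
  have hfr : ∀ (A : Type v) [CommRing A] [Algebra R A] [CharP A p] [PerfectRing A p] (r : R)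
      (s : A), (frobeniusEquiv A p).symm (r • s) =
        (frobeniusEquiv R p).symm r • (frobeniusEquiv A p).symm s := by
    intro A _ _ _ _ r s
    rw [RingEquiv.symm_apply_eq, Algebra.smul_def, Algebra.smul_def, map_mul,
      RingEquiv.apply_symm_apply, frobeniusEquiv_def, ← map_pow, ← frobeniusEquiv_def R p, RingEquiv.apply_symm_apply]
  let g : S ⊗[R] T →+ S ⊗[R] T := TensorProduct.liftAddHom
    { toFun := fun s =>
        { toFun := fun t => (frobeniusEquiv S p).symm s ⊗ₜ (frobeniusEquiv T p).symm t
          map_zero' := by simp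
          map_add' := fun _ _ => by simp [TensorProduct.tmul_add] }
      map_zero' := by ext; simp
      map_add' := fun _ _ => by ext; simp [TensorProduct.add_tmul] }
    (fun r s t => by
      change (frobeniusEquiv S p).symm (r • s) ⊗ₜ (frobeniusEquiv T p).symm t =
        (frobeniusEquiv S p).symm s ⊗ₜ[R] (frobeniusEquiv T p).symm (r • t)
      rw [hfr, hfr, TensorProduct.smul_tmul])
  have hg : ∀ s t, g (s ⊗ₜ t) = (frobeniusEquiv S p).symm s ⊗ₜ (frobeniusEquiv T p).symm t :=
    fun _ _ => rfl
  have hF : ∀ x, frobenius (S ⊗[R] T) p x = x ^ p := fun _ => rfl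
  have h1 : ∀ x, g (frobenius _ p x) = x := by
    intro x
    induction x using TensorProduct.induction_on with
    | zero => simp
    | add x y hx hy => rw [map_add, map_add, hx, hy]
    | tmul s t =>
      rw [hF, Algebra.TensorProduct.tmul_pow, hg, ← frobeniusEquiv_def, ← frobeniusEquiv_def,
        RingEquiv.symm_apply_apply, RingEquiv.symm_apply_apply]
  have h2 : ∀ x, frobenius _ p (g x) = x := by
    intro x
    induction x using TensorProduct.induction_on with
    | zero => simp
    | add x y hx hy => rw [map_add, map_add, hx, hy]
    | tmul s t =>
      rw [hF, hg, Algebra.TensorProduct.tmul_pow, ← frobeniusEquiv_def, ← frobeniusEquiv_def,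
        RingEquiv.apply_symm_apply, RingEquiv.apply_symm_apply]
  exact ⟨Function.bijective_iff_has_inverse.2 ⟨g, h1, h2⟩⟩

/-- A ring homomorphism `B₀ ⊗[A] B₁ → D` killing the kernels of surjections `B₀ → S` and `B₁ → T`
compatible with a surjection `A → R` factors through `S ⊗[R] T`. -/
theorem exists_factor_tensorProduct {A B₀ B₁ R S T D : Type*} [CommRing A] [CommRing B₀]
    [CommRing B₁] [CommRing R] [CommRing S] [CommRing T] [CommRing D] [Algebra A B₀] [Algebra A B₁]
    [Algebra R S] [Algebra R T] (ρ : A →+* R) (ρ₀ : B₀ →+* S) (ρ₁ : B₁ →+* T)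
    (hρ : Function.Surjective ρ) (hρ₀ : Function.Surjective ρ₀) (hρ₁ : Function.Surjective ρ₁)
    (h₀ : ∀ a, ρ₀ (algebraMap A B₀ a) = algebraMap R S (ρ a))
    (h₁ : ∀ a, ρ₁ (algebraMap A B₁ a) = algebraMap R T (ρ a)) (h : B₀ ⊗[A] B₁ →+* D)
    (hS : ∀ x, ρ₀ x = 0 → h (x ⊗ₜ 1) = 0) (hT : ∀ x, ρ₁ x = 0 → h (1 ⊗ₜ x) = 0) :
    ∃ G : S ⊗[R] T →+ D, ∀ x y, G (ρ₀ x ⊗ₜ ρ₁ y) = h (x ⊗ₜ y) := by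
  let i₀ : B₀ →+* D := h.comp Algebra.TensorProduct.includeLeftRingHom
  let i₁ : B₁ →+* D := h.comp (Algebra.TensorProduct.includeRight : B₁ →ₐ[A] B₀ ⊗[A] B₁).toRingHom
  let g₀ : S →+* D := RingHom.liftOfSurjective ρ₀ hρ₀ ⟨i₀, fun x hx => hS x hx⟩
  let g₁ : T →+* D := RingHom.liftOfSurjective ρ₁ hρ₁ ⟨i₁, fun x hx => hT x hx⟩
  have hg₀ : ∀ x, g₀ (ρ₀ x) = h (x ⊗ₜ 1) := fun x => RingHom.liftOfRightInverse_comp_apply _ _ _ _ _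
  have hg₁ : ∀ x, g₁ (ρ₁ x) = h (1 ⊗ₜ x) := fun x => RingHom.liftOfRightInverse_comp_apply _ _ _ _ _
  have hg : ∀ r, g₀ (algebraMap R S r) = g₁ (algebraMap R T r) := by
    intro r
    obtain ⟨a, rfl⟩ := hρ r
    rw [← h₀, ← h₁, hg₀, hg₁, Algebra.algebraMap_eq_smul_one, Algebra.algebraMap_eq_smul_one,
      TensorProduct.smul_tmul]
  refine ⟨TensorProduct.liftAddHom
    { toFun := fun s =>
        { toFun := fun t => g₀ s * g₁ t
          map_zero' := by simp
          map_add' := fun _ _ => by simp [mul_add] }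
      map_zero' := by ext; simp
      map_add' := fun _ _ => by ext; simp [add_mul] }
    (fun r s t => ?_), fun x y => ?_⟩
  · change g₀ (r • s) * g₁ t = g₀ s * g₁ (r • t)
    rw [Algebra.smul_def, Algebra.smul_def, map_mul, map_mul, hg]
    ring
  · change g₀ (ρ₀ x) * g₁ (ρ₁ y) = _
    rw [hg₀, hg₁, ← map_mul, Algebra.TensorProduct.tmul_mul_tmul, mul_one, one_mul]

/-- The reduction map `W(R) / p ^ (k + 1) → R`. -/
def WMod.residue (k : ℕ) (hp : (p : R) = 0) : WMod p (k + 1) R →+* R :=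
  Ideal.Quotient.lift _ WittVector.constantCoeff (by
    intro x hx
    obtain ⟨y, rfl⟩ := Ideal.mem_span_singleton.1 hx
    rw [map_mul, map_pow, map_natCast, hp, zero_pow (Nat.succ_ne_zero _), zero_mul])

@[simp] theorem WMod.residue_mk (k : ℕ) (hp : (p : R) = 0) (x : WittVector p R) :
    WMod.residue k hp (Ideal.Quotient.mk _ x) = WittVector.constantCoeff x := rfl

theorem WMod.residue_surjective (k : ℕ) (hp : (p : R) = 0) :
    Function.Surjective (WMod.residue k hp : WMod p (k + 1) R →+* R) := fun r => by
  obtain ⟨x, rfl⟩ := WittVector.constantCoeff_surjective (R := R) p r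
  exact ⟨Ideal.Quotient.mk _ x, rfl⟩

theorem WMod.residue_map (k : ℕ) (hR : (p : R) = 0) (hS : (p : S) = 0) (f : R →+* S)
    (x : WMod p (k + 1) R) :
    WMod.residue k hS (WMod.map (k + 1) f x) = f (WMod.residue k hR x) := by
  obtain ⟨x, rfl⟩ := Ideal.Quotient.mk_surjective x
  rfl

theorem WMod.p_dvd_iff [PerfectRing R p] (k : ℕ) (hp : (p : R) = 0) {x : WMod p (k + 1) R} :
    (p : WMod p (k + 1) R) ∣ x ↔ WMod.residue k hp x = 0 := by
  constructor
  · rintro ⟨y, rfl⟩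
    rw [map_mul, map_natCast, hp, zero_mul]
  · obtain ⟨x, rfl⟩ := Ideal.Quotient.mk_surjective x
    rw [WMod.residue_mk, ← p_dvd_iff_coeff_zero hp]
    rintro ⟨y, rfl⟩
    exact ⟨Ideal.Quotient.mk _ y, by rw [map_mul, map_natCast]⟩

theorem WMod.p_pow_dvd_of_p_mul_eq_zero [PerfectRing R p] (k : ℕ) (hp : (p : R) = 0)
    {x : WMod p (k + 1) R} (hx : (p : WMod p (k + 1) R) * x = 0) :
    (p : WMod p (k + 1) R) ^ k ∣ x := by
  obtain ⟨x, rfl⟩ := Ideal.Quotient.mk_surjective x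
  rw [← map_natCast (Ideal.Quotient.mk _), ← map_mul, mk_eq_zero_iff_dvd] at hx
  obtain ⟨y, hy⟩ := hx
  refine ⟨Ideal.Quotient.mk _ y, ?_⟩
  rw [← map_natCast (Ideal.Quotient.mk _), ← map_pow, ← map_mul]
  congr 1
  refine sub_eq_zero.1 (eq_zero_of_p_mul_eq_zero hp ?_)
  rw [mul_sub, hy]
  ring

theorem WMod.p_pow_eq_zero (k : ℕ) : (p : WMod p k R) ^ k = 0 := by
  rw [← map_natCast (Ideal.Quotient.mk _), ← map_pow, mk_eq_zero_iff_dvd]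

/-- The `W(R) / p ^ k`-algebra structure on `W(S) / p ^ k`, for an `R`-algebra `S`. -/
abbrev WMod.algebra (k : ℕ) (R S : Type v) [CommRing R] [CommRing S] [Algebra R S] :
    Algebra (WMod p k R) (WMod p k S) :=
  (WMod.map k (algebraMap R S)).toAlgebra

attribute [local instance] WMod.algebra

/-- The canonical map `W(S)/p^k ⊗_{W(R)/p^k} W(T)/p^k → W(S ⊗_R T)/p^k`. -/
def WMod.tensorMap (p : ℕ) [Fact p.Prime] (k : ℕ) (R S T : Type v) [CommRing R] [CommRing S]
    [CommRing T] [Algebra R S] [Algebra R T] :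
    WMod p k S ⊗[WMod p k R] WMod p k T →ₐ[WMod p k R] WMod p k (S ⊗[R] T) :=
  Algebra.TensorProduct.productMap
    { toRingHom := WMod.map k Algebra.TensorProduct.includeLeftRingHom
      commutes' := fun x => (WMod.map_comp k (algebraMap R S) _ x).symm.trans (by
        rfl) }
    { toRingHom := WMod.map k (Algebra.TensorProduct.includeRight : T →ₐ[R] S ⊗[R] T).toRingHom
      commutes' := fun x => (WMod.map_comp k (algebraMap R T) _ x).symm.trans (by
        rw [AlgHom.toRingHom_eq_coe, AlgHom.comp_algebraMap]
        rfl) }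

theorem WMod.tensorMap_tmul (k : ℕ) [Algebra R S] [Algebra R T] (s : WMod p k S) (t : WMod p k T) :
    WMod.tensorMap p k R S T (s ⊗ₜ t) =
      WMod.map k (Algebra.TensorProduct.includeLeftRingHom : S →+* S ⊗[R] T) s *
      WMod.map k (Algebra.TensorProduct.includeRight : T →ₐ[R] S ⊗[R] T).toRingHom t := rfl

theorem WMod.tensorMap_bijective (k : ℕ) [Algebra R S] [Algebra R T] [PerfectRing R p]
    [PerfectRing S p] [PerfectRing T p] (hR : (p : R) = 0) :
    Function.Bijective (WMod.tensorMap p (k + 1) R S T) := by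
  have hS : (p : S) = 0 := by rw [← map_natCast (algebraMap R S), hR, map_zero]
  have hT : (p : T) = 0 := by rw [← map_natCast (algebraMap R T), hR, map_zero]
  have hST : (p : S ⊗[R] T) = 0 := by
    rw [← map_natCast (algebraMap R (S ⊗[R] T)), hR, map_zero]
  have := perfectRing_tensorProduct (S := S) (T := T) hR
  let g : WMod p (k + 1) S ⊗[WMod p (k + 1) R] WMod p (k + 1) T →+* WMod p (k + 1) (S ⊗[R] T) :=
    (WMod.tensorMap p (k + 1) R S T).toRingHom
  have hgp : g (p : WMod p (k + 1) S ⊗[WMod p (k + 1) R] WMod p (k + 1) T) =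
    (p : WMod p (k + 1) (S ⊗[R] T)) := map_natCast g p
  have hres : ∀ s t, WMod.residue k hST (g (s ⊗ₜ t)) =
      WMod.residue k hS s ⊗ₜ WMod.residue k hT t := by
    intro s t
    change WMod.residue k hST (WMod.map _ _ s * WMod.map _ _ t) = _
    rw [map_mul, WMod.residue_map k hS, WMod.residue_map k hT]
    simp
  refine bijective_of_mod_nilpotent g p k ?_ ?_ ?_ ?_
  · have h := congrArg (algebraMap (WMod p (k + 1) R)
      (WMod p (k + 1) S ⊗[WMod p (k + 1) R] WMod p (k + 1) T)) (WMod.p_pow_eq_zero (k + 1))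
    rwa [map_pow, map_natCast, map_zero] at h
  · intro c
    have h1 : ∀ z : S ⊗[R] T, ∃ d, WMod.residue k hST (g d) = z := by
      intro z
      induction z using TensorProduct.induction_on with
      | zero => exact ⟨0, by rw [map_zero, map_zero]⟩
      | add x y hx hy =>
        obtain ⟨d, rfl⟩ := hx
        obtain ⟨e, rfl⟩ := hy
        exact ⟨d + e, by rw [map_add, map_add]⟩
      | tmul s t =>
        obtain ⟨s, rfl⟩ := WMod.residue_surjective k hS s
        obtain ⟨t, rfl⟩ := WMod.residue_surjective k hT t
        exact ⟨s ⊗ₜ t, hres s t⟩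
    obtain ⟨d, hd⟩ := h1 (WMod.residue k hST c)
    obtain ⟨e, he⟩ := (WMod.p_dvd_iff k hST (x := c - g d)).2 (by rw [map_sub, hd, sub_self])
    exact ⟨d, e, by rw [hgp, ← he]; ring⟩
  · -- The quotient map by `p` factors through the reduction map to `S ⊗ T`.
    intro d hd
    rw [hgp, WMod.p_dvd_iff k hST] at hd
    let I := Ideal.span {(p : WMod p (k + 1) S ⊗[WMod p (k + 1) R] WMod p (k + 1) T)}
    have hI : ∀ x, (p : WMod p (k + 1) S ⊗[WMod p (k + 1) R] WMod p (k + 1) T) * x ∈ I :=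
      fun x => Ideal.mul_mem_right _ _ (Ideal.mem_span_singleton_self _)
    obtain ⟨G, hG⟩ := exists_factor_tensorProduct (D := _ ⧸ I)
      (WMod.residue k hR) (WMod.residue k hS)
      (WMod.residue k hT) (WMod.residue_surjective k hR) (WMod.residue_surjective k hS)
      (WMod.residue_surjective k hT) (WMod.residue_map k hR hS _) (WMod.residue_map k hR hT _)
      (Ideal.Quotient.mk I) (fun x hx => by
        obtain ⟨y, rfl⟩ := (WMod.p_dvd_iff k hS).2 hx
        rw [← nsmul_eq_mul, ← TensorProduct.smul_tmul', nsmul_eq_mul]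
        exact Ideal.Quotient.eq_zero_iff_mem.2 (hI _))
      (fun x hx => by
        obtain ⟨y, rfl⟩ := (WMod.p_dvd_iff k hT).2 hx
        rw [← nsmul_eq_mul, TensorProduct.tmul_smul, nsmul_eq_mul]
        exact Ideal.Quotient.eq_zero_iff_mem.2 (hI _))
    have hG' : ∀ x, G (WMod.residue k hST (g x)) = Ideal.Quotient.mk I x := by
      intro x
      induction x using TensorProduct.induction_on with
      | zero => simp only [map_zero]
      | add x y hx hy => simp only [map_add, hx, hy]
      | tmul s t => rw [hres, hG]
    rw [← Ideal.mem_span_singleton]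
    change d ∈ I
    rw [← Ideal.Quotient.eq_zero_iff_mem, ← hG', hd, map_zero]
  · intro c hc
    rw [hgp] at hc ⊢
    exact WMod.p_pow_dvd_of_p_mul_eq_zero k hST hc

end TensorWitt

/-! ### Gluing lattices along flat covers -/

section Glue

open TensorProduct

variable {p : ℕ} [Fact p.Prime] {n : ℕ} {R S T : Type v} [CommRing R] [CommRing S] [CommRing T]

/-- The `W(R)`-linear map `W(R)^n → W(R)[1/p]^n`. -/
def intVec (p : ℕ) [Fact p.Prime] (n : ℕ) (R : Type v) [CommRing R] :
    (Fin n → WittVector p R) →ₗ[WittVector p R] (Fin n → WInv p R) :=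
  (Algebra.linearMap (WittVector p R) (WInv p R)).compLeft (Fin n)

theorem intVec_apply (w : Fin n → WittVector p R) (s : Fin n) :
    intVec p n R w s = algebraMap _ _ (w s) := rfl

theorem intVec_single (s : Fin n) :
    intVec p n R (Pi.single s 1) = Pi.single s 1 := by
  funext t
  rw [intVec_apply, Pi.single_apply, Pi.single_apply]
  split_ifs <;> simp

theorem intVec_injective [PerfectRing R p] (hp : (p : R) = 0) :
    Function.Injective (intVec p n R) := fun _ _ h =>
  funext fun s => algebraMap_injective hp (congrFun h s)

theorem mapVec_intVec (f : R →+* S) (w : Fin n → WittVector p R) :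
    mapVec f (intVec p n R w) = intVec p n S fun s => WittVector.map f (w s) :=
  funext fun _ => mapInv_algebraMap f _

theorem p_pow_smul_injective (k : ℕ) :
    Function.Injective fun z : Fin n → WInv p R => (p : WittVector p R) ^ k • z := by
  intro z z' h
  funext s
  have h1 := congrFun h s
  simp only [Pi.smul_apply, Algebra.smul_def] at h1
  exact (isUnit_p_pow k).mul_right_injective h1

theorem exists_p_pow_smul_eq (k : ℕ) (z : Fin n → WInv p R) :
    ∃ z', (p : WittVector p R) ^ k • z' = z := by
  obtain ⟨u, hu⟩ := isUnit_p_pow (p := p) (R := R) k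
  refine ⟨(↑u⁻¹ : WInv p R) • z, ?_⟩
  rw [← algebraMap_smul (WInv p R), ← hu, smul_smul, Units.mul_inv, one_smul]

theorem IsInt.smul {z : WInv p R} (hz : IsInt z) (c : WittVector p R) : IsInt (c • z) := by
  obtain ⟨d, rfl⟩ := hz
  exact ⟨c * d, by rw [map_mul, Algebra.smul_def]⟩

theorem IsInt.sum {κ : Type*} {s : Finset κ} {z : κ → WInv p R} (hz : ∀ i ∈ s, IsInt (z i)) :
    IsInt (∑ i ∈ s, z i) :=
  Subring.sum_mem (algebraMap (WittVector p R) (WInv p R)).range hz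

theorem exists_p_pow_smul_isInt {κ : Type*} [Finite κ] (z : κ → WInv p R) :
    ∃ N : ℕ, ∀ M, N ≤ M → ∀ i, IsInt ((p : WittVector p R) ^ M • z i) := by
  have := Fintype.ofFinite κ
  choose k x hx using fun i => exists_p_pow_mul (z i)
  refine ⟨Finset.univ.sup k, fun M hM i => ?_⟩
  obtain ⟨m, rfl⟩ := Nat.exists_eq_add_of_le ((Finset.le_sup (Finset.mem_univ i)).trans hM)
  rw [pow_add, mul_comm, mul_smul]
  exact IsInt.smul ⟨x i, by rw [← hx, Algebra.smul_def]⟩ _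

/-- A lattice lies between `p ^ N W(R)^n` and `p ^ (-N) W(R)^n` for all large `N`. -/
theorem IsLattice.exists_bound {L : Submodule (WittVector p R) (Fin n → WInv p R)}
    (hL : IsLattice L) : ∃ N : ℕ, ∀ M, N ≤ M →
      (∀ w, (p : WittVector p R) ^ M • intVec p n R w ∈ L) ∧
      ∀ z ∈ L, ∃ w, intVec p n R w = (p : WittVector p R) ^ M • z := by
  obtain ⟨m, x, a, h, rfl⟩ := hL.exists_isDualFrame
  obtain ⟨N₁, h₁⟩ := exists_p_pow_smul_isInt fun i : Fin m × Fin n => x i.1 i.2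
  obtain ⟨N₂, h₂⟩ := exists_p_pow_smul_isInt fun i : Fin m × Fin n => a i.1 i.2
  refine ⟨max N₁ N₂, fun M hM => ⟨fun w => ?_, fun z hz => ?_⟩⟩
  · rw [h.mem_span_iff]
    intro j
    refine IsInt.sum fun s _ => ?_
    have h3 := (h₂ M (le_of_max_le_right hM) (j, s)).smul (w s)
    rwa [Pi.smul_apply, intVec_apply, mul_smul_comm, mul_comm, ← Algebra.smul_def, smul_comm]
  · obtain ⟨c, rfl⟩ := (Submodule.mem_span_range_iff_exists_fun _).1 hz
    have h3 : ∀ s, IsInt (((p : WittVector p R) ^ M • ∑ i, c i • x i) s) := by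
      intro s
      rw [Pi.smul_apply, Finset.sum_apply, Finset.smul_sum]
      refine IsInt.sum fun j _ => ?_
      rw [Pi.smul_apply, smul_comm]
      exact (h₁ M (le_of_max_le_left hM) (j, s)).smul (c j)
    choose w hw using h3
    exact ⟨w, funext hw⟩

/-- For a lattice `L ⊆ p ^ (-N) W(R)^n`, the image of `p ^ N L` in `(W(R) / p ^ (2 N + 1))^n`. -/
def modLattice (N : ℕ) (L : Submodule (WittVector p R) (Fin n → WInv p R)) :
    Submodule (WMod p (2 * N + 1) R) (Fin n → WMod p (2 * N + 1) R) where
  carrier := {u | ∃ z ∈ L, ∃ w, intVec p n R w = (p : WittVector p R) ^ N • z ∧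
    u = fun s => Ideal.Quotient.mk _ (w s)}
  add_mem' := by
    rintro _ _ ⟨z, hz, w, hw, rfl⟩ ⟨z', hz', w', hw', rfl⟩
    exact ⟨z + z', add_mem hz hz', w + w', by rw [map_add, hw, hw', smul_add],
      funext fun s => (map_add (Ideal.Quotient.mk _) (w s) (w' s)).symm⟩
  zero_mem' := ⟨0, zero_mem _, 0, by simp, funext fun s => (map_zero _).symm⟩
  smul_mem' := by
    rintro c _ ⟨z, hz, w, hw, rfl⟩
    obtain ⟨c, rfl⟩ := Ideal.Quotient.mk_surjective c
    exact ⟨c • z, Submodule.smul_mem _ _ hz, c • w, by rw [map_smul, hw, smul_comm],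
      funext fun s => (map_mul (Ideal.Quotient.mk _) c (w s)).symm⟩

theorem mk_eq_mk_iff {k : ℕ} {w w' : Fin n → WittVector p R} :
    ((fun s => Ideal.Quotient.mk (Ideal.span {(p : WittVector p R) ^ k}) (w s)) =
      fun s => Ideal.Quotient.mk _ (w' s)) ↔ ∃ c, w = w' + (p : WittVector p R) ^ k • c := by
  constructor
  · intro h
    have h1 : ∀ s, (p : WittVector p R) ^ k ∣ w s - w' s := fun s => by
      rw [← mk_eq_zero_iff_dvd, map_sub, congrFun h s, sub_self]
    choose c hc using h1
    exact ⟨c, funext fun s => by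
      rw [Pi.add_apply, Pi.smul_apply, smul_eq_mul, ← hc]; ring⟩
  · rintro ⟨c, rfl⟩
    funext s
    rw [Pi.add_apply, map_add, Pi.smul_apply, smul_eq_mul,
      mk_eq_zero_iff_dvd.2 (dvd_mul_right _ _), add_zero]

/-- If `z` and `z'` agree modulo `p ^ (N + 1) W(R)^n`, which is contained in `L`, then `z` lies in
`L` if `z'` does. -/
theorem mem_of_mk_eq {N : ℕ} {L : Submodule (WittVector p R) (Fin n → WInv p R)}
    (hN : ∀ w, (p : WittVector p R) ^ N • intVec p n R w ∈ L) {z z' : Fin n → WInv p R}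
    {w w' : Fin n → WittVector p R} (hw : intVec p n R w = (p : WittVector p R) ^ N • z)
    (hw' : intVec p n R w' = (p : WittVector p R) ^ N • z')
    (h : (fun s => Ideal.Quotient.mk (Ideal.span {(p : WittVector p R) ^ (2 * N + 1)}) (w s)) =
      fun s => Ideal.Quotient.mk _ (w' s)) (hz' : z' ∈ L) : z ∈ L := by
  obtain ⟨c, rfl⟩ := mk_eq_mk_iff.1 h
  have h1 : z = z' + (p : WittVector p R) ^ N • intVec p n R ((p : WittVector p R) • c) := by
    apply p_pow_smul_injective N
    beta_reduce
    rw [← hw, map_add, hw', smul_add, map_smul, map_smul, smul_smul, smul_smul]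
    congr 2
    ring
  rw [h1]
  exact add_mem hz' (hN _)

/-- The vectors of `W(R)[1/p]^n` whose image under each `f i` lies in the lattice `L i`. -/
def glue {ι : Type*} {S : ι → Type v} [∀ i, CommRing (S i)] (f : ∀ i, R →+* S i)
    (L : ∀ i, Submodule (WittVector p (S i)) (Fin n → WInv p (S i))) :
    Submodule (WittVector p R) (Fin n → WInv p R) where
  carrier := {v | ∀ i, mapVec (f i) v ∈ L i}
  add_mem' := fun ha hb i => by rw [mapVec_add]; exact add_mem (ha i) (hb i)
  zero_mem' := fun i => by rw [mapVec_zero]; exact zero_mem _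
  smul_mem' := fun c v hv i => by rw [mapVec_smul]; exact Submodule.smul_mem _ _ (hv i)

section Cover

attribute [local instance] WMod.algebra

/-- Over `S ⊗[R] T`, membership of `x` in the base change of a lattice `L` over `T` translates to
a membership over `W(S)/p^(2N+1) ⊗ W(T)/p^(2N+1)`. -/
theorem tmul_one_mem_span [Algebra R S] [Algebra R T] [PerfectRing R p] [PerfectRing S p]
    [PerfectRing T p] (hR : (p : R) = 0) {N : ℕ} {L : Submodule (WittVector p T) (Fin n → WInv p T)}
    (hN : ∀ z ∈ L, ∃ w, intVec p n T w = (p : WittVector p T) ^ N • z)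
    {z : Fin n → WInv p S} {w : Fin n → WittVector p S}
    (hw : intVec p n S w = (p : WittVector p S) ^ N • z)
    (hz : mapVec (Algebra.TensorProduct.includeLeftRingHom : S →+* S ⊗[R] T) z ∈
      baseChange (Algebra.TensorProduct.includeRight : T →ₐ[R] S ⊗[R] T).toRingHom L) :
    (fun s => (Ideal.Quotient.mk _ (w s) : WMod p (2 * N + 1) S) ⊗ₜ[WMod p (2 * N + 1) R]
      (1 : WMod p (2 * N + 1) T)) ∈
    Submodule.span (WMod p (2 * N + 1) S ⊗[WMod p (2 * N + 1) R] WMod p (2 * N + 1) T)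
      ((fun (u : Fin n → WMod p (2 * N + 1) T) s =>
        (1 : WMod p (2 * N + 1) S) ⊗ₜ[WMod p (2 * N + 1) R] u s) '' modLattice N L) := by
  have := perfectRing_tensorProduct (p := p) (S := S) (T := T) hR
  have hST : (p : S ⊗[R] T) = 0 := by
    rw [← map_natCast (algebraMap R (S ⊗[R] T)), hR, map_zero]
  have hΨ := WMod.tensorMap_bijective (p := p) (2 * N) (S := S) (T := T) hR
  have key : ∀ z' ∈ baseChange (Algebra.TensorProduct.includeRight : T →ₐ[R] S ⊗[R] T).toRingHom L,
      ∃ u ∈ Submodule.span (WMod p (2 * N + 1) S ⊗[WMod p (2 * N + 1) R] WMod p (2 * N + 1) T)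
        ((fun (u : Fin n → WMod p (2 * N + 1) T) s =>
          (1 : WMod p (2 * N + 1) S) ⊗ₜ[WMod p (2 * N + 1) R] u s) '' modLattice N L),
        ∃ w', intVec p n (S ⊗[R] T) w' = (p : WittVector p (S ⊗[R] T)) ^ N • z' ∧
          ∀ s, WMod.tensorMap p (2 * N + 1) R S T (u s) = Ideal.Quotient.mk _ (w' s) := by
    intro z' hz'
    induction hz' using Submodule.span_induction with
    | zero => exact ⟨0, zero_mem _, 0, by simp, fun s => by simp⟩
    | add y z _ _ hy hz =>
      obtain ⟨u, hu, w, hw, h⟩ := hy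
      obtain ⟨u', hu', w', hw', h'⟩ := hz
      exact ⟨u + u', add_mem hu hu', w + w', by rw [map_add, hw, hw', smul_add], fun s => by
        rw [Pi.add_apply, map_add, h, h', Pi.add_apply, map_add]⟩
    | smul c y _ hy =>
      obtain ⟨u, hu, w, hw, h⟩ := hy
      obtain ⟨d, hd⟩ := hΨ.2 (Ideal.Quotient.mk _ c)
      exact ⟨d • u, Submodule.smul_mem _ _ hu, c • w, by rw [map_smul, hw, smul_comm], fun s => by
        rw [Pi.smul_apply, smul_eq_mul, map_mul, hd, h, Pi.smul_apply, smul_eq_mul, map_mul]⟩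
    | mem y hy =>
      obtain ⟨y, hy, rfl⟩ := hy
      obtain ⟨w, hw⟩ := hN y hy
      refine ⟨_, Submodule.subset_span ⟨_, ⟨y, hy, w, hw, rfl⟩, rfl⟩,
        fun s => WittVector.map
          (Algebra.TensorProduct.includeRight : T →ₐ[R] S ⊗[R] T).toRingHom (w s), ?_, fun s => ?_⟩
      · rw [← mapVec_intVec, hw, mapVec_smul, map_pow, map_natCast]
      · rw [WMod.tensorMap_tmul, map_one, one_mul, WMod.map_mk]
  obtain ⟨u, hu, w', hw', h⟩ := key _ hz
  convert hu using 1
  funext s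
  apply hΨ.1
  rw [h, WMod.tensorMap_tmul, map_one, mul_one, WMod.map_mk]
  have h1 := mapVec_intVec (Algebra.TensorProduct.includeLeftRingHom : S →+* S ⊗[R] T) w
  rw [hw, mapVec_smul, map_pow, map_natCast, ← hw'] at h1
  rw [congrFun (intVec_injective hST h1) s]

variable {ι : Type} [Fintype ι] {S : ι → Type v} [∀ i, CommRing (S i)] [∀ i, Algebra R (S i)]
  [PerfectRing R p] [∀ i, PerfectRing (S i) p]

/-- Flat descent of lattices: the glued submodule generates each of the given lattices. -/
theorem baseChange_glue (hR : (p : R) = 0) (hflat : ∀ i, Module.Flat R (S i))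
    {L : ∀ i, Submodule (WittVector p (S i)) (Fin n → WInv p (S i))} (hL : ∀ i, IsLattice (L i))
    (hc : ∀ i j, baseChange
        (Algebra.TensorProduct.includeLeftRingHom : S i →+* S i ⊗[R] S j) (L i) =
      baseChange (Algebra.TensorProduct.includeRight : S j →ₐ[R] S i ⊗[R] S j).toRingHom (L j))
    (i : ι) : baseChange (algebraMap R (S i)) (glue (fun i => algebraMap R (S i)) L) = L i := by
  have hS : ∀ i, (p : S i) = 0 := fun i => by
    rw [← map_natCast (algebraMap R (S i)), hR, map_zero]
  apply le_antisymm
  · refine Submodule.span_le.2 ?_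
    rintro _ ⟨v, hv, rfl⟩
    exact hv i
  intro z hz
  choose N' hN' using fun i => (hL i).exists_bound
  obtain ⟨N, hN⟩ : ∃ N, ∀ i, N' i ≤ N :=
    ⟨Finset.univ.sup N', fun i => Finset.le_sup (Finset.mem_univ i)⟩
  have hN₁ := fun i => (hN' i N (hN i)).1
  have hN₂ := fun i => (hN' i N (hN i)).2
  obtain ⟨w, hw⟩ := hN₂ i z hz
  have hfl : Module.Flat (WMod p (2 * N + 1) R) (WMod p (2 * N + 1) (S i)) := by
    refine WMod.flat_map hR (hS i) (algebraMap R (S i)) ?_ _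
    have := hflat i
    exact RingHom.flat_algebraMap_iff.2 this
  -- Modulo `p ^ (2 * N + 1)`, the vector `p ^ N z` is a combination of vectors over `R` which lie
  -- in the reductions of all `p ^ N L j`; lifts of these belong to `p ^ N` times the glued module.
  have h1 := mem_span_of_flat (A := WMod p (2 * N + 1) R)
    (fun j => modLattice N (L j)) (fun s => (Ideal.Quotient.mk _ (w s) : WMod p (2 * N + 1) (S i)))
    (fun j => tmul_one_mem_span hR (hN₂ j) hw
      (by rw [← hc]; exact Submodule.subset_span ⟨z, hz, rfl⟩))
  have hglue : ∀ w, (p : WittVector p (S i)) ^ N • intVec p n (S i) w ∈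
      baseChange (algebraMap R (S i)) (glue (fun i => algebraMap R (S i)) L) := by
    intro w
    have h2 : intVec p n (S i) w =
        ∑ s, w s • mapVec (algebraMap R (S i)) (intVec p n R (Pi.single s 1)) := by
      conv_lhs => rw [pi_eq_sum_univ' w, map_sum]
      simp only [map_smul, intVec_single, mapVec_single]
    rw [h2, Finset.smul_sum]
    refine Submodule.sum_mem _ fun s _ => ?_
    rw [smul_comm]
    refine Submodule.smul_mem _ _ (Submodule.subset_span
      ⟨(p : WittVector p R) ^ N • intVec p n R (Pi.single s 1), fun j => ?_, ?_⟩)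
    · rw [mapVec_smul, map_pow, map_natCast, mapVec_intVec]
      exact hN₁ j _
    · rw [mapVec_smul, map_pow, map_natCast]
  have key : ∀ u ∈ Submodule.span (WMod p (2 * N + 1) (S i))
      ((fun (v : Fin n → WMod p (2 * N + 1) R) s =>
        algebraMap (WMod p (2 * N + 1) R) (WMod p (2 * N + 1) (S i)) (v s)) ''
        {v | ∀ j, (fun s => algebraMap (WMod p (2 * N + 1) R) (WMod p (2 * N + 1) (S j)) (v s)) ∈
          modLattice N (L j)}),
      ∃ z' ∈ baseChange (algebraMap R (S i)) (glue (fun i => algebraMap R (S i)) L),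
        ∃ w', intVec p n (S i) w' = (p : WittVector p (S i)) ^ N • z' ∧
          u = fun s => Ideal.Quotient.mk _ (w' s) := by
    intro u hu
    induction hu using Submodule.span_induction with
    | zero => exact ⟨0, zero_mem _, 0, by simp, funext fun s => (map_zero _).symm⟩
    | add _ _ _ _ hy hy' =>
      obtain ⟨z, hz, w, hw, rfl⟩ := hy
      obtain ⟨z', hz', w', hw', rfl⟩ := hy'
      exact ⟨z + z', add_mem hz hz', w + w', by rw [map_add, hw, hw', smul_add],
        funext fun s => (map_add (Ideal.Quotient.mk _) (w s) (w' s)).symm⟩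
    | smul c y _ hy =>
      obtain ⟨z, hz, w, hw, rfl⟩ := hy
      obtain ⟨c, rfl⟩ := Ideal.Quotient.mk_surjective c
      exact ⟨c • z, Submodule.smul_mem _ _ hz, c • w, by rw [map_smul, hw, smul_comm],
        funext fun s => (map_mul (Ideal.Quotient.mk _) c (w s)).symm⟩
    | mem y hy =>
      obtain ⟨v, hv, rfl⟩ := hy
      choose v' hv' using fun s => Ideal.Quotient.mk_surjective (v s)
      obtain rfl : (fun s => Ideal.Quotient.mk _ (v' s)) = v := funext hv'
      obtain ⟨y, hy⟩ := exists_p_pow_smul_eq N (intVec p n R v')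
      have hyj : ∀ j, intVec p n (S j) (fun s => WittVector.map (algebraMap R (S j)) (v' s)) =
          (p : WittVector p (S j)) ^ N • mapVec (algebraMap R (S j)) y := by
        intro j
        rw [← mapVec_intVec, ← hy, mapVec_smul, map_pow, map_natCast]
      refine ⟨mapVec (algebraMap R (S i)) y, Submodule.subset_span ⟨y, fun j => ?_, rfl⟩, _,
        hyj i, rfl⟩
      obtain ⟨z', hz', w', hw', h⟩ := hv j
      exact mem_of_mk_eq (hN₁ j) (hyj j) hw' h hz'
  obtain ⟨z', hz', w', hw', h⟩ := key _ h1
  exact mem_of_mk_eq hglue hw hw' h hz'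

end Cover

end Glue

section GlueIsLattice

open TensorProduct

variable {p : ℕ} [Fact p.Prime] {n : ℕ} {R : Type v} [CommRing R]

/-- Values of a multilinear map on tuples in a span lie in a submodule as soon as the values on
tuples of generators do. -/
theorem multilinear_mem_of_span {A M N : Type*} [CommRing A] [AddCommGroup M] [AddCommGroup N]
    [Module A M] [Module A N] (φ : MultilinearMap A (fun _ : Fin n => M) N) {X : Set M}
    {J : Submodule A N} (h : ∀ y : Fin n → M, (∀ i, y i ∈ X) → φ y ∈ J) (y : Fin n → M)
    (hy : ∀ i, y i ∈ Submodule.span A X) : φ y ∈ J := by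
  suffices ∀ (s : Finset (Fin n)) (y : Fin n → M), (∀ i ∈ s, y i ∈ Submodule.span A X) →
      (∀ i ∉ s, y i ∈ X) → φ y ∈ J from
    this Finset.univ y (fun i _ => hy i) (by simp)
  intro s
  induction s using Finset.induction_on with
  | empty => exact fun y _ hy => h y fun i => hy i (Finset.notMem_empty i)
  | insert a s has ih =>
    intro y hy hy'
    suffices ∀ z ∈ Submodule.span A X, φ (Function.update y a z) ∈ J by
      have h1 := this (y a) (hy a (Finset.mem_insert_self a s))
      rwa [Function.update_eq_self] at h1
    intro z hz
    induction hz using Submodule.span_induction with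
    | zero => rw [φ.map_update_zero]; exact zero_mem _
    | add z w _ _ hz hw => rw [φ.map_update_add]; exact add_mem hz hw
    | smul c z _ hz => rw [φ.map_update_smul]; exact J.smul_mem c hz
    | mem z hz =>
      refine ih _ (fun i hi => ?_) fun i hi => ?_
      · rw [Function.update_of_ne (by rintro rfl; exact has hi)]
        exact hy i (Finset.mem_insert_of_mem hi)
      · by_cases hia : i = a
        · subst hia
          rwa [Function.update_self]
        · rw [Function.update_of_ne hia]
          exact hy' i (by simp [hia, hi])

/-- The map `b ↦ det (bᵢ · yⱼ)` as a `W(R)`-multilinear map. -/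
def gramDet (y : Fin n → Fin n → WInv p R) :
    MultilinearMap (WittVector p R) (fun _ : Fin n => Fin n → WInv p R) (WInv p R) :=
  (Matrix.detRowAlternating.compLinearMap
    (Matrix.mulVecLin (Matrix.of y))).toMultilinearMap.restrictScalars (WittVector p R)

theorem gramDet_apply (y b : Fin n → Fin n → WInv p R) :
    gramDet y b = (Matrix.of fun i j => b i ⬝ᵥ y j).det := by
  have : (Matrix.of fun i j => b i ⬝ᵥ y j) = Matrix.of fun i j => y j ⬝ᵥ b i := by
    ext i j
    exact dotProduct_comm (b i) (y j)
  rw [this]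
  rfl

theorem gramDet_comm (y b : Fin n → Fin n → WInv p R) : gramDet y b = gramDet b y := by
  rw [gramDet_apply, gramDet_apply, ← Matrix.det_transpose]
  congr 1
  ext i j
  exact dotProduct_comm (b j) (y i)

/-- Minors are compatible with base change. -/
theorem minors_baseChange_subset {S : Type v} [CommRing S] [PerfectRing S p] (hS : (p : S) = 0)
    (f : R →+* S) {L L' : Submodule (WittVector p R) (Fin n → WInv p R)} (hL : L' ≤ dualLattice L) :
    minors (baseChange f L) (baseChange f L') ⊆
      Ideal.map (WittVector.map f : WittVector p R →+* WittVector p S)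
        (Ideal.span (minors L L')) := by
  rintro d ⟨y, b, hy, hb, hd⟩
  let J : Submodule (WittVector p S) (WInv p S) :=
    Submodule.map (Algebra.linearMap (WittVector p S) (WInv p S))
      (Ideal.map (WittVector.map f : WittVector p R →+* WittVector p S) (Ideal.span (minors L L')))
  suffices gramDet y b ∈ J by
    obtain ⟨e, he, heq⟩ := this
    rw [gramDet_apply, ← hd] at heq
    rwa [← algebraMap_injective hS heq]
  refine multilinear_mem_of_span _ (fun b hb => ?_) b hb
  rw [gramDet_comm]
  refine multilinear_mem_of_span _ (fun y hy => ?_) y hy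
  choose b' hb' hbb using hb
  choose y' hy' hyy using hy
  choose c hc using fun i j => hL (hb' i) (y' j) (hy' j)
  have h1 : algebraMap _ (WInv p R) (Matrix.of c).det =
      (Matrix.of fun i j => b' i ⬝ᵥ y' j).det := by
    rw [RingHom.map_det]
    congr 1
    ext i j
    simp [hc]
  refine ⟨WittVector.map f (Matrix.of c).det,
    Ideal.mem_map_of_mem _ (Ideal.subset_span ⟨y', b', hy', hb', h1⟩), ?_⟩
  rw [gramDet_comm, gramDet_apply, Algebra.linearMap_apply, ← mapInv_algebraMap, h1,
    RingHom.map_det]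
  congr 1
  ext i j
  simp [← hbb, ← hyy, mapInv_dotProduct]

variable {ι : Type} {S : ι → Type v} [∀ i, CommRing (S i)] [∀ i, Algebra R (S i)]

/-- A family of flat homomorphisms which is jointly surjective on spectra is jointly injective. -/
theorem eq_zero_of_algebraMap_eq_zero (hflat : ∀ i, Module.Flat R (S i))
    (hsurj : ∀ x : PrimeSpectrum R, ∃ (i : ι) (y : PrimeSpectrum (S i)),
      PrimeSpectrum.comap (algebraMap R (S i)) y = x) (r : R)
    (hr : ∀ i, algebraMap R (S i) r = 0) : r = 0 := by
  by_contra h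
  let I : Ideal R := LinearMap.ker (LinearMap.toSpanSingleton R R r)
  have hI : I ≠ ⊤ := by
    rw [Ne, Ideal.eq_top_iff_one]
    simpa [I] using h
  obtain ⟨m, hm, hIm⟩ := Ideal.exists_le_maximal I hI
  obtain ⟨i, y, hy⟩ := hsurj ⟨m, hm.isPrime⟩
  have := hflat i
  obtain ⟨l, a, z, h1, h2⟩ := Module.Flat.isTrivialRelation_of_sum_smul_eq_zero (R := R) (M := S i)
    (ι := Unit) (f := fun _ => r) (x := fun _ => 1) (by simp [Algebra.smul_def, hr])
  apply y.isPrime.ne_top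
  rw [Ideal.eq_top_iff_one]
  have h3 : (1 : S i) = ∑ j, a () j • z j := h1 ()
  rw [h3]
  refine Ideal.sum_mem _ fun j _ => ?_
  rw [Algebra.smul_def]
  refine Ideal.mul_mem_right _ _ ?_
  have h4 : a () j ∈ m := hIm (by
    have := h2 j
    simp only [Finset.univ_unique, Finset.sum_singleton] at this
    simpa [I, mul_comm] using this)
  have h5 : a () j ∈ (PrimeSpectrum.comap (algebraMap R (S i)) y).asIdeal := by rw [hy]; exact h4
  exact h5

variable [Fintype ι] [PerfectRing R p] [∀ i, PerfectRing (S i) p]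

/-- Flat descent of lattices: lattices over the members of a flat cover which agree on the overlaps
come from a lattice on the base. The glued submodule and the glued submodule of the dual lattices
are in duality; their minors generate the unit ideal of `W(R)`, because they do so modulo every
prime of `R`, as can be checked on the cover. -/
theorem exists_isLattice_baseChange_eq (hR : (p : R) = 0) (hflat : ∀ i, Module.Flat R (S i))
    (hsurj : ∀ x : PrimeSpectrum R, ∃ (i : ι) (y : PrimeSpectrum (S i)),
      PrimeSpectrum.comap (algebraMap R (S i)) y = x)
    {L : ∀ i, Submodule (WittVector p (S i)) (Fin n → WInv p (S i))} (hL : ∀ i, IsLattice (L i))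
    (hc : ∀ i j, baseChange
        (Algebra.TensorProduct.includeLeftRingHom : S i →+* S i ⊗[R] S j) (L i) =
      baseChange (Algebra.TensorProduct.includeRight : S j →ₐ[R] S i ⊗[R] S j).toRingHom (L j)) :
    ∃ L₀ : Submodule (WittVector p R) (Fin n → WInv p R), IsLattice L₀ ∧
      ∀ i, baseChange (algebraMap R (S i)) L₀ = L i := by
  have hS : ∀ i, (p : S i) = 0 := fun i => by
    rw [← map_natCast (algebraMap R (S i)), hR, map_zero]
  have hinj := eq_zero_of_algebraMap_eq_zero hflat hsurj
  let L₀ := glue (fun i => algebraMap R (S i)) L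
  let D₀ := glue (fun i => algebraMap R (S i)) fun i => dualLattice (L i)
  have hL₀ : ∀ i, baseChange (algebraMap R (S i)) L₀ = L i := baseChange_glue hR hflat hL hc
  have hD₀ : ∀ i, baseChange (algebraMap R (S i)) D₀ = dualLattice (L i) :=
    baseChange_glue hR hflat (fun i => (hL i).dualLattice (hS i)) fun i j => by
      rw [← (hL i).dualLattice_baseChange, ← (hL j).dualLattice_baseChange, hc]
  have hdual : D₀ ≤ dualLattice L₀ := fun b hb y hy =>
    isInt_of_map hR hS _ hinj fun i => by
      rw [← mapInv_dotProduct]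
      exact hb i _ (hy i)
  -- Otherwise the minors lie in a maximal ideal of `W(R)`, which contains `p`; by surjectivity on
  -- spectra it lies below a prime of some `S i`, where the minors generate the unit ideal.
  have htop : Ideal.span (minors L₀ D₀) = ⊤ := by
    by_contra h
    let I := Ideal.map (WittVector.constantCoeff : WittVector p R →+* R) (Ideal.span (minors L₀ D₀))
    have hI : I ≠ ⊤ := by
      intro hI
      obtain ⟨c, hc, hc1⟩ := (Ideal.mem_map_iff_of_surjective _
        (WittVector.constantCoeff_surjective (R := R) p)).1 ((Ideal.eq_top_iff_one I).1 hI)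
      exact h (Ideal.eq_top_of_isUnit_mem _ hc
        ((isUnit_iff_isUnit_constantCoeff hR).2 (by rw [hc1]; exact isUnit_one)))
    obtain ⟨m, hm, hIm⟩ := Ideal.exists_le_maximal I hI
    obtain ⟨i, y, hy⟩ := hsurj ⟨m, hm.isPrime⟩
    have h1 : Ideal.span (minors (L i) (dualLattice (L i))) ≤
        Ideal.comap WittVector.constantCoeff y.asIdeal := by
      rw [Ideal.span_le, ← hD₀ i]
      conv_lhs => rw [← hL₀ i]
      refine (minors_baseChange_subset (hS i) _ hdual).trans ?_
      rw [SetLike.coe_subset_coe, Ideal.map_le_iff_le_comap, Ideal.comap_comap]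
      intro c hc
      have h2 : WittVector.constantCoeff c ∈ m := hIm (Ideal.mem_map_of_mem _ hc)
      have h3 : WittVector.constantCoeff c ∈
        (PrimeSpectrum.comap (algebraMap R (S i)) y).asIdeal := by rw [hy]; exact h2
      exact h3
    rw [(hL i).span_minors (hS i), top_le_iff] at h1
    exact y.isPrime.ne_top (by
      rw [Ideal.eq_top_iff_one, ← map_one (WittVector.constantCoeff : WittVector p (S i) →+* S i),
        ← Ideal.mem_comap, h1]
      trivial)
  obtain ⟨m, x, a, hxa, hx, ha⟩ := exists_isDualFrame_of_span_minors hdual htop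
  refine ⟨L₀, ?_, hL₀⟩
  have : L₀ = Submodule.span (WittVector p R) (Set.range x) := by
    apply le_antisymm
    · exact fun v hv => hxa.mem_span_iff.2 fun j => hdual (ha j) v hv
    · rw [Submodule.span_le]
      rintro _ ⟨j, rfl⟩
      exact hx j
  rw [this]
  exact hxa.isLattice hR

/-- A lattice is determined by its base changes along a jointly injective family. -/
theorem IsLattice.ext_of_baseChange {ι : Type*} {S : ι → Type v} [∀ i, CommRing (S i)]
    (hp : (p : R) = 0) [∀ i, PerfectRing (S i) p] (hS : ∀ i, (p : S i) = 0)
    (f : ∀ i, R →+* S i) (hf : ∀ r, (∀ i, f i r = 0) → r = 0)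
    {L L' : Submodule (WittVector p R) (Fin n → WInv p R)} (hL : IsLattice L) (hL' : IsLattice L')
    (h : ∀ i, WittLattice.baseChange (f i) L = WittLattice.baseChange (f i) L') : L = L' := by
  apply le_antisymm
  · exact fun v hv => hL'.mem_of_map hp hS f hf fun i => by
      rw [← h]; exact Submodule.subset_span ⟨v, hv, rfl⟩
  · exact fun v hv => hL.mem_of_map hp hS f hf fun i => by
      rw [h]; exact Submodule.subset_span ⟨v, hv, rfl⟩

end GlueIsLattice

/-! ### Lattices are free locally for the Zariski topology -/

section LocallyFree

variable {p : ℕ} [Fact p.Prime] {n : ℕ} {R : Type v} [CommRing R]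

/-- Every lattice becomes free on a cover of the base by principal open subsets: it does so where
the reduction of one of its minors is invertible. -/
theorem IsLattice.exists_isFreeLattice_baseChange [PerfectRing R p] (hp : (p : R) = 0)
    {L : Submodule (WittVector p R) (Fin n → WInv p R)} (hL : IsLattice L) :
    ∃ (m : ℕ) (r : Fin m → R), Ideal.span (Set.range r) = ⊤ ∧
      ∀ (i : Fin m) (S : Type v) [CommRing S] [PerfectRing S p] (f : R →+* S),
        (p : S) = 0 → IsUnit (f (r i)) → IsFreeLattice (WittLattice.baseChange f L) := by
  have h1 : Ideal.span (WittVector.constantCoeff '' minors L (WittLattice.dualLattice L)) = ⊤ := by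
    rw [← Ideal.map_span, hL.span_minors hp, Ideal.map_top]
  obtain ⟨s, hs, hs1⟩ := (Ideal.span_eq_top_iff_finite _).1 h1
  refine ⟨s.card, fun i => s.equivFin.symm i, ?_, fun i S _ _ f hS hu => ?_⟩
  · rw [← hs1]
    congr 1
    ext r
    simp only [Set.mem_range, SetLike.mem_coe]
    constructor
    · rintro ⟨i, rfl⟩
      exact (s.equivFin.symm i).2
    · intro hr
      exact ⟨s.equivFin ⟨r, hr⟩, by simp⟩
  · obtain ⟨d, hd, hdr⟩ := hs (s.equivFin.symm i).2
    have h2 := minors_map f hd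
    rw [← hL.dualLattice_baseChange] at h2
    refine isFreeLattice_of_isUnit hS h2 ?_
    rw [isUnit_iff_isUnit_constantCoeff hS, constantCoeff_map, hdr]
    exact hu

end LocallyFree

/-! ### Pushouts and localizations of perfect algebras -/

section PerfectAlgebras

open TensorProduct

/-- A point of `Spec S` whose image in `Spec R` lies in the image of `Spec T` lifts to
`Spec (S ⊗[R] T)`: the tensor product of the two residue fields over that of the common image is
nonzero, and each of its prime ideals gives such a point. -/
theorem exists_comap_includeLeft_eq {R S T : Type*} [CommRing R] [CommRing S] [CommRing T]
    [Algebra R S] [Algebra R T] (y : PrimeSpectrum S) (t : PrimeSpectrum T)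
    (h : PrimeSpectrum.comap (algebraMap R S) y = PrimeSpectrum.comap (algebraMap R T) t) :
    ∃ z : PrimeSpectrum (S ⊗[R] T),
      PrimeSpectrum.comap Algebra.TensorProduct.includeLeftRingHom z = y := by
  let P := y.asIdeal.under R
  have hP : P = t.asIdeal.comap (algebraMap R T) := congrArg PrimeSpectrum.asIdeal h
  let := (Ideal.ResidueField.map P y.asIdeal (algebraMap R S) rfl).toAlgebra
  let := (Ideal.ResidueField.map P t.asIdeal (algebraMap R T) hP).toAlgebra
  have : IsScalarTower R P.ResidueField y.asIdeal.ResidueField :=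
    .of_algebraMap_eq fun r => (Ideal.ResidueField.map_algebraMap P _ _ _ r).symm
  have : IsScalarTower R P.ResidueField t.asIdeal.ResidueField :=
    .of_algebraMap_eq fun r => (Ideal.ResidueField.map_algebraMap P _ _ _ r).symm
  let N := y.asIdeal.ResidueField ⊗[P.ResidueField] t.asIdeal.ResidueField
  let φ : S ⊗[R] T →ₐ[R] N := Algebra.TensorProduct.productMap
    (((Algebra.TensorProduct.includeLeft : _ →ₐ[P.ResidueField] N).restrictScalars R).comp
      (IsScalarTower.toAlgHom R S y.asIdeal.ResidueField))
    (((Algebra.TensorProduct.includeRight : _ →ₐ[P.ResidueField] N).restrictScalars R).comp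
      (IsScalarTower.toAlgHom R T t.asIdeal.ResidueField))
  obtain ⟨M, hM⟩ := Ideal.exists_maximal N
  refine ⟨PrimeSpectrum.comap φ.toRingHom ⟨M, hM.isPrime⟩, ?_⟩
  ext s
  have h1 : φ (s ⊗ₜ 1) = algebraMap S y.asIdeal.ResidueField s ⊗ₜ 1 := by
    simp only [φ, Algebra.TensorProduct.productMap_apply_tmul, map_one, mul_one]
    rfl
  change φ (s ⊗ₜ 1) ∈ M ↔ s ∈ y.asIdeal
  rw [h1, ← Ideal.algebraMap_residueField_eq_zero (I := y.asIdeal)]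
  constructor
  · intro h2
    by_contra h3
    have h4 : IsUnit (Algebra.TensorProduct.includeLeft (S := P.ResidueField)
        (algebraMap S y.asIdeal.ResidueField s) : N) := (IsUnit.mk0 _ h3).map _
    exact hM.ne_top (Ideal.eq_top_of_isUnit_mem _ h2 h4)
  · intro h2
    rw [h2, TensorProduct.zero_tmul]
    exact zero_mem _

/-- Localizations of perfect rings are perfect: `a / s` is the `p`-th power of `b / s` if
`b ^ p = a * s ^ (p - 1)`. -/
theorem perfectRing_of_isLocalization {p : ℕ} [Fact p.Prime] {R S : Type v} [CommRing R]
    [CommRing S] [Algebra R S] [PerfectRing R p] (hp : (p : R) = 0) (r : R)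
    [IsLocalization.Away r S] : PerfectRing S p := by
  rcases subsingleton_or_nontrivial S with h | h
  · exact ⟨⟨fun x y _ => Subsingleton.elim x y, fun x => ⟨x, Subsingleton.elim _ _⟩⟩⟩
  have : Nontrivial R := (algebraMap R S).domain_nontrivial
  have : CharP R p := (CharP.charP_iff_prime_eq_zero Fact.out).2 hp
  have : CharP S p := (CharP.charP_iff_prime_eq_zero Fact.out).2 (by
    rw [← map_natCast (algebraMap R S), hp, map_zero])
  have : IsReduced R := (isReduced_iff_pow_one_lt p (Fact.out : p.Prime).one_lt).2 fun x hx =>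
    injective_frobenius R p (hx.trans (map_zero _).symm)
  have : IsReduced S := isReduced_localizationPreserves (Submonoid.powers r) S ‹_›
  refine PerfectRing.ofSurjective S p fun x => ?_
  obtain ⟨⟨a, s⟩, hs⟩ := IsLocalization.surj (Submonoid.powers r) x
  obtain ⟨b, hb⟩ := surjective_frobenius R p (a * (s : R) ^ (p - 1))
  have hu := IsLocalization.map_units S s
  refine ⟨IsLocalization.mk' S b s, (hu.pow p).mul_left_injective ?_⟩
  change (_ : S) ^ p * _ = _
  rw [← mul_pow, IsLocalization.mk'_spec, ← map_pow, ← frobenius_def, hb, map_mul]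
  simp only at hs
  rw [← hs, map_pow, mul_assoc, ← pow_succ', Nat.sub_add_cancel (Fact.out : p.Prime).one_le]

variable {p : ℕ} {k : Type u} [Field k]

instance (R : PerfAlg.{v} p k) : PerfectRing R.obj p := R.property

/-- The morphism of perfect `k`-algebras given by a ring homomorphism compatible with the structure
maps of `k`-algebras. -/
def PerfAlg.homMk {A B : PerfAlg.{v} p k} (f : A.obj →+* B.obj)
    (hf : ∀ c : k, f (algebraMap k A.obj c) = algebraMap k B.obj c) : A ⟶ B :=
  ObjectProperty.homMk (CommAlgCat.ofHom { toRingHom := f, commutes' := hf })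

theorem PerfAlg.toRingHom_algebraMap {A B : PerfAlg.{v} p k} (f : A ⟶ B) (c : k) :
    PerfAlg.toRingHom f (algebraMap k A.obj c) = algebraMap k B.obj c :=
  f.hom.hom.commutes c

theorem PerfAlg.hom_ext {A B : PerfAlg.{v} p k} {f g : A ⟶ B}
    (h : PerfAlg.toRingHom f = PerfAlg.toRingHom g) : f = g :=
  ObjectProperty.hom_ext _ (CommAlgCat.hom_ext (AlgHom.ext fun x => RingHom.congr_fun h x))

/-- The object of the category of perfect `k`-algebras given by an `A`-algebra `B`, where `A` is a
perfect `k`-algebra and `B` a perfect ring. -/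
def PerfAlg.ofAlgebra (A : PerfAlg.{v} p k) (B : Type v) [CommRing B] [Algebra A.obj B]
    (hB : PerfectRing B p) : PerfAlg.{v} p k :=
  letI := ((algebraMap A.obj B).comp (algebraMap k A.obj)).toAlgebra
  ⟨CommAlgCat.of k B, hB⟩

/-- The structure morphism of `PerfAlg.ofAlgebra`. -/
def PerfAlg.toOfAlgebra (A : PerfAlg.{v} p k) (B : Type v) [CommRing B] [Algebra A.obj B]
    (hB : PerfectRing B p) : A ⟶ A.ofAlgebra B hB :=
  PerfAlg.homMk (B := A.ofAlgebra B hB) (algebraMap A.obj B) fun _ => rfl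

variable [Fact p.Prime] [CharP k p]

/-- Pushouts in the category of perfect `k`-algebras are tensor products. -/
theorem PerfAlg.exists_isPushout {R S T : PerfAlg.{v} p k} (f : R ⟶ S) (g : R ⟶ T) :
    letI := (PerfAlg.toRingHom f).toAlgebra
    letI := (PerfAlg.toRingHom g).toAlgebra
    ∃ (hP : PerfectRing (S.obj ⊗[R.obj] T.obj) p)
      (inr : T ⟶ S.ofAlgebra (S.obj ⊗[R.obj] T.obj) hP),
      PerfAlg.toRingHom inr =
        (Algebra.TensorProduct.includeRight : T.obj →ₐ[R.obj] S.obj ⊗[R.obj] T.obj).toRingHom ∧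
      IsPushout f g (S.toOfAlgebra _ hP) inr := by
  let := (PerfAlg.toRingHom f).toAlgebra
  let := (PerfAlg.toRingHom g).toAlgebra
  have hP : PerfectRing (S.obj ⊗[R.obj] T.obj) p :=
    perfectRing_tensorProduct (PerfAlg.natCast_eq_zero p k R)
  have hw : ∀ r : R.obj, (PerfAlg.toRingHom f r) ⊗ₜ[R.obj] (1 : T.obj) =
      (1 : S.obj) ⊗ₜ[R.obj] (PerfAlg.toRingHom g r) := fun r =>
    (Algebra.TensorProduct.includeLeft.commutes r).trans
      (Algebra.TensorProduct.includeRight.commutes r).symm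
  let inr : T ⟶ S.ofAlgebra (S.obj ⊗[R.obj] T.obj) hP :=
    PerfAlg.homMk (B := S.ofAlgebra (S.obj ⊗[R.obj] T.obj) hP)
      (Algebra.TensorProduct.includeRight :
        T.obj →ₐ[R.obj] S.obj ⊗[R.obj] T.obj).toRingHom fun c => by
      have := hw (algebraMap k R.obj c)
      rw [PerfAlg.toRingHom_algebraMap, PerfAlg.toRingHom_algebraMap] at this
      exact this.symm
  refine ⟨hP, inr, rfl, ⟨⟨PerfAlg.hom_ext (RingHom.ext hw)⟩, ⟨?_⟩⟩⟩
  have key : ∀ s : Limits.PushoutCocone f g,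
      ∃ d : S.ofAlgebra (S.obj ⊗[R.obj] T.obj) hP ⟶ s.pt,
        S.toOfAlgebra _ hP ≫ d = s.inl ∧ inr ≫ d = s.inr := by
    intro s
    let := (PerfAlg.toRingHom (f ≫ s.inl)).toAlgebra
    let a : S.obj →ₐ[R.obj] s.pt.obj :=
      { toRingHom := PerfAlg.toRingHom s.inl, commutes' := fun _ => rfl }
    let b : T.obj →ₐ[R.obj] s.pt.obj :=
      { toRingHom := PerfAlg.toRingHom s.inr
        commutes' := fun r => RingHom.congr_fun (congrArg PerfAlg.toRingHom s.condition.symm) r }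
    let φ := Algebra.TensorProduct.productMap a b
    have ha : ∀ x : S.obj, φ (x ⊗ₜ 1) = PerfAlg.toRingHom s.inl x := fun x =>
      Algebra.TensorProduct.productMap_left_apply a b x
    have hb : ∀ x : T.obj, φ (1 ⊗ₜ x) = PerfAlg.toRingHom s.inr x := fun x =>
      Algebra.TensorProduct.productMap_right_apply a b x
    exact ⟨PerfAlg.homMk (A := S.ofAlgebra (S.obj ⊗[R.obj] T.obj) hP) φ.toRingHom
        fun c => (ha _).trans (PerfAlg.toRingHom_algebraMap s.inl c),
      PerfAlg.hom_ext (RingHom.ext ha), PerfAlg.hom_ext (RingHom.ext hb)⟩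
  choose d hd₁ hd₂ using key
  refine Limits.PushoutCocone.IsColimit.mk _ d hd₁ hd₂ fun s m h₁ h₂ => PerfAlg.hom_ext ?_
  refine RingHom.ext fun x => ?_
  induction x using TensorProduct.induction_on with
  | zero => exact (map_zero (PerfAlg.toRingHom m)).trans (map_zero (PerfAlg.toRingHom (d s))).symm
  | add x y hx hy =>
    exact (map_add (PerfAlg.toRingHom m) x y).trans
      ((congrArg₂ (· + ·) hx hy).trans (map_add (PerfAlg.toRingHom (d s)) x y).symm)
  | tmul x y =>
    have e : (x ⊗ₜ[R.obj] y : S.obj ⊗[R.obj] T.obj) = (x ⊗ₜ 1) * (1 ⊗ₜ y) := by simp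
    have e₁ : PerfAlg.toRingHom m (x ⊗ₜ[R.obj] (1 : T.obj)) =
        PerfAlg.toRingHom (d s) (x ⊗ₜ[R.obj] (1 : T.obj)) :=
      RingHom.congr_fun (congrArg PerfAlg.toRingHom (h₁.trans (hd₁ s).symm)) x
    have e₂ : PerfAlg.toRingHom m ((1 : S.obj) ⊗ₜ[R.obj] y) =
        PerfAlg.toRingHom (d s) ((1 : S.obj) ⊗ₜ[R.obj] y) :=
      RingHom.congr_fun (congrArg PerfAlg.toRingHom (h₂.trans (hd₂ s).symm)) y
    rw [e]
    exact (map_mul (PerfAlg.toRingHom m) _ _).trans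
      ((congrArg₂ (· * ·) e₁ e₂).trans (map_mul (PerfAlg.toRingHom (d s)) _ _).symm)

end PerfectAlgebras

/-! ### Coverings of perfect `k`-algebras -/

section Coverings

open TensorProduct

variable (p : ℕ) (k : Type u) [Field k]

theorem zariskiPrecoverage_le_fpqcPrecoverage :
    zariskiPrecoverage.{v} p k ≤ fpqcPrecoverage.{v} p k := by
  rintro X _ ⟨m, Y, f, r, hr, hloc, rfl⟩
  refine ⟨m, Y, f, fun i => ?_, fun x => ?_, rfl⟩
  · let := (PerfAlg.toRingHom (f i).unop).toAlgebra
    have := hloc i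
    exact IsLocalization.flat (Y i).unop.obj (Submonoid.powers (r i))
  · obtain ⟨i, hi⟩ : ∃ i, r i ∉ x.asIdeal := by
      by_contra! h
      refine x.isPrime.ne_top (top_le_iff.1 (hr ▸ Ideal.span_le.2 ?_))
      rintro _ ⟨i, rfl⟩
      exact h i
    let := (PerfAlg.toRingHom (f i).unop).toAlgebra
    have := hloc i
    have h : x ∈ Set.range (PrimeSpectrum.comap (algebraMap X.unop.obj (Y i).unop.obj)) := by
      rw [PrimeSpectrum.localization_away_comap_range (Y i).unop.obj (r i)]
      exact hi
    exact ⟨i, h⟩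

theorem zariskiTopology_le_fpqcTopology : zariskiTopology.{v} p k ≤ fpqcTopology.{v} p k :=
  Precoverage.toGrothendieck_mono (zariskiPrecoverage_le_fpqcPrecoverage p k)

variable {p k}
variable [Fact p.Prime] [CharP k p]

/-- The pullback of an fpqc covering is generated by an fpqc covering. -/
theorem exists_mem_fpqcPrecoverage_generate_eq {X Y : PerfAff.{v} p k} (g : Y ⟶ X)
    {R : Presieve X} (hR : R ∈ fpqcPrecoverage.{v} p k X) :
    ∃ R' ∈ fpqcPrecoverage.{v} p k Y, Sieve.generate R' = (Sieve.generate R).pullback g := by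
  obtain ⟨m, Z, f, hflat, hsurj, rfl⟩ := hR
  let := (PerfAlg.toRingHom g.unop).toAlgebra
  let (i : Fin m) := (PerfAlg.toRingHom (f i).unop).toAlgebra
  choose hP inr hinr hpush using fun i => PerfAlg.exists_isPushout g.unop (f i).unop
  refine ⟨_, ⟨m, fun i => op (Y.unop.ofAlgebra (Y.unop.obj ⊗[X.unop.obj] (Z i).unop.obj) (hP i)),
    fun i => (Y.unop.toOfAlgebra _ (hP i)).op, fun i => ?_, fun y => ?_, rfl⟩,
    Sieve.ofArrows_eq_pullback_of_isPullback f fun i => (hpush i).op.flip⟩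
  · have : Module.Flat X.unop.obj (Z i).unop.obj := hflat i
    exact (RingHom.flat_algebraMap_iff (R := Y.unop.obj)
      (S := Y.unop.obj ⊗[X.unop.obj] (Z i).unop.obj)).2 inferInstance
  · obtain ⟨i, t, ht⟩ := hsurj (PrimeSpectrum.comap (PerfAlg.toRingHom g.unop) y)
    obtain ⟨z, hz⟩ := exists_comap_includeLeft_eq (R := X.unop.obj) y t ht.symm
    exact ⟨i, z, hz⟩

/-- Fpqc coverings are stable under base change, so that the sheaf condition for the topology they
generate only needs to be checked on the coverings themselves. -/
theorem isSheaf_fpqcTopology_of_isSheafFor {F : (PerfAff.{v} p k)ᵒᵖ ⥤ Type v}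
    (h : ∀ (X : PerfAff.{v} p k), ∀ R ∈ fpqcPrecoverage.{v} p k X, R.IsSheafFor F) :
    Presheaf.IsSheaf (fpqcTopology.{v} p k) F := by
  rw [isSheaf_iff_isSheaf_of_type]
  refine (Precoverage.isSheaf_toGrothendieck_iff F).2 fun R hR => ?_
  obtain ⟨R', hR', e⟩ := exists_mem_fpqcPrecoverage_generate_eq _ hR
  rw [← e, ← Presieve.isSheafFor_iff_generate]
  exact h _ _ hR'

/-- Elements generating the unit ideal define a covering sieve for the Zariski topology. -/
theorem ofArrows_mem_zariskiTopology (X : PerfAff.{v} p k) {m : ℕ} {r : Fin m → X.unop.obj}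
    (hr : Ideal.span (Set.range r) = ⊤) :
    Sieve.ofArrows _ (fun i => (X.unop.toOfAlgebra (Localization.Away (r i))
      (perfectRing_of_isLocalization (PerfAlg.natCast_eq_zero p k X.unop) (r i))).op) ∈
      zariskiTopology.{v} p k X := by
  refine Precoverage.generate_mem_toGrothendieck ⟨m, _, _, r, hr, fun i => ?_, rfl⟩
  -- The two algebra structures agree only up to a proof, since their scalar actions differ.
  have e : (algebraMap X.unop.obj (Localization.Away (r i))).toAlgebra =
      (inferInstance : Algebra X.unop.obj (Localization.Away (r i))) :=
    Algebra.algebra_ext _ _ fun _ => rfl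
  have h : letI := (algebraMap X.unop.obj (Localization.Away (r i))).toAlgebra
      IsLocalization.Away (r i) (Localization.Away (r i)) := by
    rw [e]
    infer_instance
  exact h

end Coverings

/-! ### Descent of lattices along fpqc coverings -/

section Descent

variable {p : ℕ} [Fact p.Prime] {k : Type u} [Field k] [CharP k p] {n : ℕ}

/-- Lattices over the members of an fpqc covering of `X` which agree on all overlaps come from a
unique lattice over `X`. -/
theorem existsUnique_latPresheaf {X : PerfAff.{v} p k} {m : ℕ} {Y : Fin m → PerfAff.{v} p k}
    {f : ∀ i, Y i ⟶ X} (hflat : ∀ i, (PerfAlg.toRingHom (f i).unop).Flat)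
    (hsurj : ∀ x : PrimeSpectrum X.unop.obj, ∃ (i : Fin m) (y : PrimeSpectrum (Y i).unop.obj),
      PrimeSpectrum.comap (PerfAlg.toRingHom (f i).unop) y = x)
    (x : ∀ i, (latPresheaf.{v} p k n).obj (op (Y i)))
    (hx : Presieve.Arrows.Compatible (latPresheaf.{v} p k n) f x) :
    ∃! t, ∀ i, (latPresheaf.{v} p k n).map (f i).op t = x i := by
  let (i : Fin m) := (PerfAlg.toRingHom (f i).unop).toAlgebra
  have hp := PerfAlg.natCast_eq_zero p k X.unop
  have hzero := eq_zero_of_algebraMap_eq_zero (R := X.unop.obj) (S := fun i => (Y i).unop.obj)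
    hflat hsurj
  obtain ⟨L₀, hL₀, h⟩ := exists_isLattice_baseChange_eq (p := p) (R := X.unop.obj)
    (S := fun i => (Y i).unop.obj) hp hflat hsurj (L := fun i => (x i).1) (fun i => (x i).2)
    (fun i j => by
      obtain ⟨hP, inr, hinr, hpush⟩ := PerfAlg.exists_isPushout (f i).unop (f j).unop
      have := congrArg Subtype.val
        (hx i j _ ((Y i).unop.toOfAlgebra _ hP).op inr.op (congrArg Quiver.Hom.op hpush.w))
      rw [← hinr]
      exact this)
  refine ⟨⟨L₀, hL₀⟩, fun i => Subtype.ext (h i), fun t ht => Subtype.ext ?_⟩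
  exact IsLattice.ext_of_baseChange hp (fun i => PerfAlg.natCast_eq_zero p k (Y i).unop)
    (fun i => PerfAlg.toRingHom (f i).unop) hzero t.2 hL₀
    fun i => (congrArg Subtype.val (ht i)).trans (h i).symm

theorem isSheaf_latPresheaf :
    Presheaf.IsSheaf (fpqcTopology.{v} p k) (latPresheaf.{v} p k n) := by
  refine isSheaf_fpqcTopology_of_isSheafFor ?_
  rintro X _ ⟨m, Y, f, hflat, hsurj, rfl⟩
  exact (Presieve.isSheafFor_arrows_iff _ _).2 (existsUnique_latPresheaf hflat hsurj)

theorem isSheaf_specialLat :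
    Presheaf.IsSheaf (fpqcTopology.{v} p k) (specialLat.{v} p k n).toFunctor := by
  refine isSheaf_fpqcTopology_of_isSheafFor ?_
  rintro X _ ⟨m, Y, f, hflat, hsurj, rfl⟩
  refine (Presieve.isSheafFor_arrows_iff _ _).2 fun x hx => ?_
  obtain ⟨t, ht, huniq⟩ := existsUnique_latPresheaf hflat hsurj (fun i => (x i).1)
    fun i j Z gi gj h => congrArg Subtype.val (hx i j Z gi gj h)
  have hs : IsSpecial t.1 := by
    let (i : Fin m) := (PerfAlg.toRingHom (f i).unop).toAlgebra
    refine IsSpecial.of_map (PerfAlg.natCast_eq_zero p k X.unop)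
      (fun i => PerfAlg.natCast_eq_zero p k (Y i).unop)
      (fun i => PerfAlg.toRingHom (f i).unop)
      (eq_zero_of_algebraMap_eq_zero (R := X.unop.obj) (S := fun i => (Y i).unop.obj)
        hflat hsurj) t.2 fun i => ?_
    have e : baseChange (PerfAlg.toRingHom (f i).unop) t.1 = (x i).1.1 :=
      congrArg Subtype.val (ht i)
    rw [e]
    exact (x i).2
  exact ⟨⟨t, hs⟩, fun i => Subtype.ext (ht i), fun t' ht' => Subtype.ext
    (huniq t'.1 fun i => congrArg Subtype.val (ht' i))⟩

/-- Lattices are free locally for the Zariski topology. -/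
theorem exists_mem_zariskiTopology_isFreeLattice (X : PerfAff.{v} p k)
    (L : (latPresheaf.{v} p k n).obj (op X)) :
    ∃ S ∈ zariskiTopology.{v} p k X, ∀ ⦃Y : PerfAff.{v} p k⦄ (f : Y ⟶ X), S f →
      IsFreeLattice ((latPresheaf.{v} p k n).map f.op L).1 := by
  obtain ⟨m, r, hr, h⟩ := L.2.exists_isFreeLattice_baseChange
    (PerfAlg.natCast_eq_zero p k X.unop)
  refine ⟨_, ofArrows_mem_zariskiTopology X hr, fun Z f hf => ?_⟩
  obtain ⟨_, g, _, ⟨i⟩, rfl⟩ := hf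
  exact h i Z.unop.obj
    ((PerfAlg.toRingHom g.unop).comp (PerfAlg.toRingHom (X.unop.toOfAlgebra _ _)))
    (PerfAlg.natCast_eq_zero p k Z.unop)
    ((IsLocalization.Away.algebraMap_isUnit (S := Localization.Away (r i)) (r i)).map
      (PerfAlg.toRingHom g.unop))

end Descent

/-! ### Sheafification by locally surjective monomorphisms -/

section Sheafification

variable {C : Type*} [Category* C] {J : GrothendieckTopology C} {F G : Cᵒᵖ ⥤ Type v}

/-- A monomorphism of presheaves which is locally surjective and whose target is a sheaf is a
sheafification. -/
theorem isSheafification_of_injective {η : F ⟶ G} (hG : Presheaf.IsSheaf J G)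
    (hinj : ∀ X, Function.Injective (η.app X))
    (hsurj : ∀ (X : C) (s : G.obj (op X)), Presheaf.imageSieve η s ∈ J X) :
    IsSheafification J η where
  isSheaf := hG
  isLocallyInjective := Presheaf.isLocallyInjective_of_injective J η hinj
  isLocallySurjective := ⟨hsurj _⟩
  existsUnique_lift H hH α := by
    rw [isSheaf_iff_isSheaf_of_type] at hH
    -- The value of the lift at `s` is glued from the values of `α` at local preimages of `s`.
    have key : ∀ (X : C) (s : G.obj (op X)), ∃! t : H.obj (op X),
        ∀ (Y : C) (f : Y ⟶ X) (y : F.obj (op Y)), η.app _ y = G.map f.op s →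
          H.map f.op t = α.app _ y := by
      intro X s
      choose y hy using fun (Y : C) (f : Y ⟶ X) (hf : Presheaf.imageSieve η s f) => hf
      have hcompat : Presieve.FamilyOfElements.Compatible (P := H)
          (fun Y f (hf : (Presheaf.imageSieve η s).arrows f) => α.app _ (y Y f hf)) := by
        intro Y₁ Y₂ Z g₁ g₂ f₁ f₂ h₁ h₂ e
        refine (NatTrans.naturality_apply α g₁.op _).symm.trans
          (Eq.trans ?_ (NatTrans.naturality_apply α g₂.op _))
        refine congrArg (α.app (op Z)) (hinj _ ?_)
        rw [NatTrans.naturality_apply, NatTrans.naturality_apply, hy Y₁ f₁ h₁, hy Y₂ f₂ h₂,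
          ← Functor.map_comp_apply, ← Functor.map_comp_apply, ← op_comp, ← op_comp, e]
      obtain ⟨t, ht, huniq⟩ := hH _ (hsurj X s) _ hcompat
      refine ⟨t, fun Y f z hz => ?_, fun t' ht' => huniq t' fun Y f hf => ht' Y f _ (hy Y f hf)⟩
      have hf : Presheaf.imageSieve η s f := ⟨z, hz⟩
      exact (ht f hf).trans (congrArg (α.app (op Y)) (hinj _ ((hy Y f hf).trans hz.symm)))
    choose β hβ huniq using key
    refine ⟨{ app := fun X => ↾fun s => β X.unop s, naturality := fun X Y g => ?_ }, ?_,
      fun γ hγ => ?_⟩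
    · refine ConcreteCategory.hom_ext _ _ fun s => (huniq Y.unop (G.map g s) _ ?_).symm
      intro Z f y h
      refine Eq.trans ?_ (hβ X.unop s Z (f ≫ g.unop) y ?_)
      · exact (Functor.map_comp_apply H g f.op _).symm
      · exact h.trans (Functor.map_comp_apply G g f.op _).symm
    · refine NatTrans.ext (funext fun X => ConcreteCategory.hom_ext _ _ fun y => ?_)
      have := hβ X.unop (η.app X y) X.unop (𝟙 _) y (by simp)
      simpa using this
    · refine NatTrans.ext (funext fun X => ConcreteCategory.hom_ext _ _ fun s => ?_)
      refine huniq X.unop s _ fun Y f y h => ?_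
      refine (NatTrans.naturality_apply γ f.op s).symm.trans ?_
      refine (congrArg (γ.app (op Y)) h.symm).trans ?_
      exact ConcreteCategory.congr_hom (NatTrans.congr_app hγ (op Y)) y

variable {p : ℕ} [Fact p.Prime] {k : Type u} [Field k] [CharP k p] {n : ℕ}
  {J : GrothendieckTopology (PerfAff.{v} p k)}

theorem isSheafification_freeLat (hJ : zariskiTopology.{v} p k ≤ J)
    (hG : Presheaf.IsSheaf J (latPresheaf.{v} p k n)) :
    IsSheafification J (freeLat.{v} p k n).ι := by
  refine isSheafification_of_injective hG (fun _ => Subtype.val_injective) fun X L => ?_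
  obtain ⟨S, hS, h⟩ := exists_mem_zariskiTopology_isFreeLattice X L
  exact J.superset_covering (fun Y f hf => ⟨⟨_, h f hf⟩, rfl⟩) (hJ X hS)

theorem isSheafification_freeSpecialLat (hJ : zariskiTopology.{v} p k ≤ J)
    (hG : Presheaf.IsSheaf J (specialLat.{v} p k n).toFunctor) :
    IsSheafification J (Subfunctor.homOfLe (freeSpecialLat_le.{v} p k n)) := by
  refine isSheafification_of_injective hG
    (fun _ x y h => Subtype.ext (show x.1 = y.1 from congrArg (fun z => z.1) h)) fun X L => ?_
  obtain ⟨S, hS, h⟩ := exists_mem_zariskiTopology_isFreeLattice X L.1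
  exact J.superset_covering
    (fun Y f hf => ⟨⟨_, h f hf, ((specialLat p k n).toFunctor.map f.op L).2⟩, rfl⟩) (hJ X hS)

end Sheafification

end WittLattice

end

open WittLattice in
theorem mainTheorem3 (p : ℕ) [Fact p.Prime] (k : Type u) [Field k] [CharP k p] [PerfectRing k p]
    (n : ℕ) :
    -- the lattice functor is the Zariski sheafification of the functor of free lattices
    IsSheafification (zariskiTopology.{v} p k) (freeLat.{v} p k n).ι ∧
    -- it is an fpqc sheaf, and the fpqc sheafification of the functor of free lattices
    Presheaf.IsSheaf (fpqcTopology.{v} p k) (latPresheaf.{v} p k n) ∧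
    IsSheafification (fpqcTopology.{v} p k) (freeLat.{v} p k n).ι ∧
    -- the same for special lattices
    IsSheafification (zariskiTopology.{v} p k)
      (Subfunctor.homOfLe (freeSpecialLat_le.{v} p k n)) ∧
    Presheaf.IsSheaf (fpqcTopology.{v} p k) (specialLat.{v} p k n).toFunctor ∧
    IsSheafification (fpqcTopology.{v} p k)
      (Subfunctor.homOfLe (freeSpecialLat_le.{v} p k n)) := by
  have hle := zariskiTopology_le_fpqcTopology.{v} p k
  have hL := isSheaf_latPresheaf.{v} (p := p) (k := k) (n := n)
  have hS := isSheaf_specialLat.{v} (p := p) (k := k) (n := n)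
  exact ⟨isSheafification_freeLat le_rfl (fun E => Presieve.isSheaf_of_le _ hle (hL E)), hL,
    isSheafification_freeLat hle hL,
    isSheafification_freeSpecialLat le_rfl (fun E => Presieve.isSheaf_of_le _ hle (hS E)), hS,
    isSheafification_freeSpecialLat hle hS⟩
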